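/- Let $\mathcal F=\mathbb C[t,t^{-1}]\otimes\Lambda(\xi_1,\xi_2,\xi_3,\eta_1,\eta_2,\eta_3)$, where $t$ is even and the $\xi_j,\eta_j$ are odd, let $p(f)$ be the parity of $f$, and let $E=\sum_j\bigl(\xi_j\frac{\partial}{\partial\xi_j}+\eta_j\frac{\partial}{\partial\eta_j}\bigr)$ (left derivatives). Let $\mathfrak g=\mathfrak k^L(1|6)$ be the Lie superalgebra over $\mathbb C$ with elements $K_f$, $f\in\mathcal F$ (where $f\mapsto K_f$ is a linear, parity preserving isomorphism), and bracket $[K_f,K_g]=K_{\{f,g\}}$, where, for homogeneous $f$, \[ \{f,g\}=(2-E)(f)\frac{\partial g}{\partial t}-\frac{\partial f}{\partial t}(2-E)(g)+(-1)^{p(f)}\sum_{j=1}^{3}\Bigl(\frac{\partial f}{\partial \xi_j}\frac{\partial g}{\partial \eta_j}+\frac{\partial f}{\partial \eta_j}\frac{\partial g}{\partial \xi_j}\Bigr). \] Put $H_i=K_{\xi_i\eta_i}$ for $i=1,2,3$, and \[ H_4=K_t,\quad H_5=K_{t^{-1}\xi_2\xi_3\eta_3\eta_2},\quad H_6=K_{t^{-1}\xi_1\xi_3\eta_3\eta_1},\quad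 H_7=K_{t^{-1}\xi_1\xi_2\eta_2\eta_1},\quad H_8=K_{t^{-2}\xi_1\xi_2\xi_3\eta_3\eta_2\eta_1}. \] The weight of an element is its list of eigenvalues under $\operatorname{ad}H_4;\operatorname{ad}H_1,\operatorname{ad}H_2,\operatorname{ad}H_3$: with this bracket, $K_{t^a\xi^\alpha\eta^\beta}$, $\alpha,\beta\in\{0,1\}^3$, has weight $(2(a-1)+|\alpha|+|\beta|;\ \beta_1-\alpha_1,\ \beta_2-\alpha_2,\ \beta_3-\alpha_3)$. Weights are compared lexicographically. The root vectors $e_\alpha$ are the $K_m$ for the monomials $m$ of nonzero weight, and $\alpha>0$ means that the weight is positive. Let $B(K_f,K_g)=\operatorname{Res}(fg)$, where $\operatorname{Res}$ is the coefficient of $t^{-1}\xi_1\xi_2\xi_3\eta_3\eta_2\eta_1$. Then $B$ is an even, supersymmetric, invariant, nondegenerate bilinear form on $\mathfrak g$. For each monomial $m$ let $K_m^*$ be the right dual of $K_m$, i.e. the multiple of $K_{m'}$, where $m'$ is the complementary monomial, for which $B(K_m,K_m^*)=1$; then $B(K_m,K_n^*)=\delta_{m,n}$ for all monomials $m,n$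 (with the odd variables written in a fixed order), and $H_i^*=H_{i+4}$ for $i=1,2,3,4$. Let $\widehat U$ be the completion of the enveloping algebra $U(\mathfrak g)$ in the ring topology for which the left ideals $U(\mathfrak g)\,\mathfrak g_{\ge N}$, $N\ge 0$, form a basis of neighbourhoods of $0$; here $\mathfrak g_{\ge N}$ is spanned by the vectors $K_m$ whose $\operatorname{ad}H_4$-eigenvalue is at least $N$. \textbf{Lemma 1.} The sum $\sum_{\alpha>0}e_\alpha^*e_\alpha$ converges in $\widehat U$, and the element \[ C_2=\sum_{\alpha>0}e_\alpha^*e_\alpha+\sum_{i=1}^{4}H_iH_i^*+4H_5+2H_6-4H_8 \] belongs to the center of $\widehat U$. -/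

import Mathlib

set_option maxSynthPendingDepth 3

noncomputable section

namespace ContactK16

/-! ## Functions on the `(1|6)`-dimensional supercircle

The six odd coordinates are numbered in the order `ξ₁, ξ₂, ξ₃, η₃, η₂, η₁`. -/

/-- The monomials `t ^ a * θ_S`: the pair `(a, S)` stands for `t ^ a` times the product, in
increasing order, of the odd coordinates with index in `S`. -/
abbrev Mon : Type := ℤ × Finset (Fin 6)

/-- The complex vector space `ℂ[t⁻¹, t] ⊗ Λ(ξ₁, ξ₂, ξ₃, η₃, η₂, η₁)` on the basis of monomials.
As generating functions, its elements are also the elements of the Lie superalgebra `k^L(1|6)`: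
the function `f` stands for the contact vector field `K_f`. -/
abbrev Fun : Type := Mon →₀ ℂ

/-- The monomial `m` as a function, and at the same time the basis vector `K_m`. -/
def mon (m : Mon) : Fun := Finsupp.single m 1

/-- The index of the odd coordinate `ξ_{j+1}`. -/
def xi (j : Fin 3) : Fin 6 := Fin.castLE (by norm_num) j

/-- The index of the odd coordinate `η_{j+1}`. -/
def eta (j : Fin 3) : Fin 6 := Fin.rev (xi j)

/-- The sign in `θ_S θ_T = ± θ_{S ∪ T}`; it is `0` when `S` and `T` have a common element. -/
def mulSign (S T : Finset (Fin 6)) : ℤ :=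
  if Disjoint S T then (-1) ^ ((S ×ˢ T).filter (fun p => p.2 < p.1)).card else 0

/-- The supercommutative product of functions. -/
def mul : Fun →ₗ[ℂ] Fun →ₗ[ℂ] Fun :=
  Finsupp.linearCombination ℂ fun m => Finsupp.linearCombination ℂ fun n =>
    Finsupp.single (m.1 + n.1, m.2 ∪ n.2) (mulSign m.2 n.2 : ℂ)

/-- The partial derivative `∂/∂t`. -/
def dt : Fun →ₗ[ℂ] Fun :=
  Finsupp.linearCombination ℂ fun m => Finsupp.single (m.1 - 1, m.2) (m.1 : ℂ)

/-- The (left) partial derivative `∂/∂θ_i` in the odd coordinate with index `i`. -/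
def dtheta (i : Fin 6) : Fun →ₗ[ℂ] Fun :=
  Finsupp.linearCombination ℂ fun m =>
    if i ∈ m.2 then
      Finsupp.single (m.1, m.2.erase i) ((-1) ^ (m.2.filter (fun j => j < i)).card)
    else 0

/-- The Euler operator `E = ∑ θ_i ∂/∂θ_i`: it multiplies `t ^ a * θ_S` by the number of elements
of `S`. -/
def euler : Fun →ₗ[ℂ] Fun :=
  Finsupp.linearCombination ℂ fun m => Finsupp.single m (m.2.card : ℂ)

/-- The parity involution `f ↦ (-1) ^ p(f) * f`. -/
def parityInv : Fun →ₗ[ℂ] Fun :=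
  Finsupp.linearCombination ℂ fun m => Finsupp.single m ((-1) ^ m.2.card)

/-- The functions, or generating functions of fields, of parity `p`. -/
def homog (p : ZMod 2) : Submodule ℂ Fun :=
  Finsupp.supported ℂ ℂ {m : Mon | (m.2.card : ZMod 2) = p}

/-- The sign `(-1) ^ (p * q)`. -/
def koszul (p q : ZMod 2) : ℂ := (-1) ^ (p.val * q.val)

/-! ## The contact bracket -/

/-- The operator `2 - E`. -/
def twoSubEuler : Fun →ₗ[ℂ] Fun := (2 : ℂ) • LinearMap.id - euler

/-- The Poisson bracket
`{f, g} = -(-1) ^ p(f) * ∑_j (∂f/∂ξ_j * ∂g/∂η_j + ∂f/∂η_j * ∂g/∂ξ_j)`. -/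
def poisson : Fun →ₗ[ℂ] Fun →ₗ[ℂ] Fun :=
  -∑ j : Fin 3,
    (mul.compl₁₂ (dtheta (xi j) ∘ₗ parityInv) (dtheta (eta j)) +
      mul.compl₁₂ (dtheta (eta j) ∘ₗ parityInv) (dtheta (xi j)))

/-- The contact bracket
`(2 - E)(f) * ∂g/∂t - ∂f/∂t * (2 - E)(g) - {f, g}_{Poisson}`; it is the bracket of the Lie
superalgebra `k^L(1|6)` in terms of generating functions. -/
def bracket : Fun →ₗ[ℂ] Fun →ₗ[ℂ] Fun :=
  mul.compl₁₂ twoSubEuler dt - mul.compl₁₂ dt twoSubEuler - poisson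

/-! ## The Cartan subalgebra and the roots -/

/-- The monomials whose fields are `H₁, …, H₈` (at the positions `0, …, 7`):
`ξ₁η₁`, `ξ₂η₂`, `ξ₃η₃`, `t`, `t⁻¹ξ₂ξ₃η₃η₂`, `t⁻¹ξ₁ξ₃η₃η₁`, `t⁻¹ξ₁ξ₂η₂η₁`,
`t⁻²ξ₁ξ₂ξ₃η₃η₂η₁`. -/
def cartanMon : Fin 8 → Mon :=
  ![(0, {xi 0, eta 0}), (0, {xi 1, eta 1}), (0, {xi 2, eta 2}), (1, ∅),
    (-1, {xi 1, xi 2, eta 2, eta 1}), (-1, {xi 0, xi 2, eta 2, eta 0}),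
    (-1, {xi 0, xi 1, eta 1, eta 0}), (-2, {xi 0, xi 1, xi 2, eta 2, eta 1, eta 0})]

/-- The elements `H₁, …, H₈` (at the positions `0, …, 7`). -/
def H (i : Fin 8) : Fun := mon (cartanMon i)

/-- The position in the list `H₁, …, H₈` of the `i`-th element of the ordered basis
`H₄; H₁, H₂, H₃` of the diagonalizing subalgebra. -/
def diagIdx : Fin 4 → Fin 8 := ![3, 0, 1, 2]

/-- The degree of the field of a monomial, which is its eigenvalue under `ad H₄`. -/
def deg (m : Mon) : ℤ := 2 * (m.1 - 1) + m.2.card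

/-- The weight of the field of a monomial: its eigenvalues under `ad H₄; ad H₁, ad H₂, ad H₃`. -/
def weight (m : Mon) : Fin 4 → ℤ :=
  Fin.cons (deg m) fun j : Fin 3 =>
    (if eta j ∈ m.2 then 1 else 0) - (if xi j ∈ m.2 then 1 else 0)

/-- The positive root vectors: weights are compared lexicographically. -/
def IsPositive (m : Mon) : Prop := 0 < toLex (weight m)

/-! ## The invariant form and the right duals -/

/-- The residue: the coefficient of `t⁻¹ξ₁ξ₂ξ₃η₃η₂η₁`. -/
def res : Fun →ₗ[ℂ] ℂ := Finsupp.lapply (-1, Finset.univ)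

/-- The bilinear form `B(K_f, K_g) = Res (f * g)`. -/
def form : Fun →ₗ[ℂ] Fun →ₗ[ℂ] ℂ := mul.compr₂ res

/-- The monomial `t ^ (-1 - a) * θ_{Sᶜ}` complementary to `t ^ a * θ_S`. -/
def compl (m : Mon) : Mon := (-1 - m.1, m.2ᶜ)

/-- The right dual of the basis vector `K_m`: the multiple `e` of the basis vector of the
complementary monomial for which `B(K_m, e) = 1`. -/
def rightDual (m : Mon) : Fun := (form (mon m) (mon (compl m)))⁻¹ • mon (compl m)

/-! ## The enveloping algebra -/

/-- The defining relations `x * y - (-1) ^ (p(x) * p(y)) * y * x = [x, y]`, for homogeneous `x`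
and `y`. -/
inductive Rel : TensorAlgebra ℂ Fun → TensorAlgebra ℂ Fun → Prop
  | of (p q : ZMod 2) (x y : Fun) (hx : x ∈ homog p) (hy : y ∈ homog q) :
      Rel (TensorAlgebra.ι ℂ x * TensorAlgebra.ι ℂ y -
          koszul p q • (TensorAlgebra.ι ℂ y * TensorAlgebra.ι ℂ x))
        (TensorAlgebra.ι ℂ (bracket x y))

/-- The enveloping algebra of the Lie superalgebra `k^L(1|6)`. -/
def U : Type := RingQuot Rel

instance : Ring U := inferInstanceAs (Ring (RingQuot Rel))

instance : Algebra ℂ U := inferInstanceAs (Algebra ℂ (RingQuot Rel))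

/-- The canonical map from the Lie superalgebra to its enveloping algebra. -/
def ι : Fun →ₗ[ℂ] U := (RingQuot.mkAlgHom ℂ Rel).toLinearMap ∘ₗ TensorAlgebra.ι ℂ

/-- The left ideal of the enveloping algebra generated by the elements of degree at least `N`. -/
def leftIdeal (N : ℕ) : Ideal U := Ideal.span {u | ∃ m : Mon, (N : ℤ) ≤ deg m ∧ u = ι (mon m)}

/-! ### The left ideals define a ring topology -/

theorem leftIdeal_anti {M N : ℕ} (h : N ≤ M) : leftIdeal M ≤ leftIdeal N := by
  apply Ideal.span_mono
  rintro u ⟨m, hm, rfl⟩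
  exact ⟨m, le_trans (by exact_mod_cast h) hm, rfl⟩

/-- The span of the monomials with `2 * a + |S| = k`. -/
def graded (k : ℤ) : Submodule ℂ Fun :=
  Finsupp.supported ℂ ℂ {m : Mon | 2 * m.1 + (m.2.card : ℤ) = k}

theorem single_mem_graded {m : Mon} {k : ℤ} {c : ℂ} (h : 2 * m.1 + (m.2.card : ℤ) = k) :
    Finsupp.single m c ∈ graded k :=
  Finsupp.single_mem_supported ℂ c h

theorem mon_mem_graded (m : Mon) : mon m ∈ graded (deg m + 2) :=
  single_mem_graded (by unfold deg; ring)

theorem graded_induct {k : ℤ} {P : Submodule ℂ Fun} {x : Fun} (hx : x ∈ graded k)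
    (h : ∀ m : Mon, 2 * m.1 + (m.2.card : ℤ) = k → mon m ∈ P) : x ∈ P := by
  rw [graded, Finsupp.supported_eq_span_single] at hx
  refine Submodule.span_le.2 ?_ hx
  rintro _ ⟨m, hm, rfl⟩
  exact h m hm

theorem mul_mem_graded {k l : ℤ} {x y : Fun} (hx : x ∈ graded k) (hy : y ∈ graded l) :
    mul x y ∈ graded (k + l) := by
  refine graded_induct (P := (graded (k + l)).comap (mul.flip y)) hx fun m hm => ?_
  change mul (mon m) y ∈ graded (k + l)
  refine graded_induct (P := (graded (k + l)).comap (mul (mon m))) hy fun n hn => ?_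
  change mul (mon m) (mon n) ∈ graded (k + l)
  simp only [mul, mon, Finsupp.linearCombination_single, one_smul]
  by_cases hd : Disjoint m.2 n.2
  · apply single_mem_graded
    simp only [Finset.card_union_of_disjoint hd]
    push_cast
    linarith
  · simp [mulSign, hd]

theorem dt_mem_graded {k : ℤ} {x : Fun} (hx : x ∈ graded k) : dt x ∈ graded (k - 2) := by
  refine graded_induct (P := (graded (k - 2)).comap dt) hx fun m hm => ?_
  change dt (mon m) ∈ graded (k - 2)
  simp only [dt, mon, Finsupp.linearCombination_single, one_smul]
  apply single_mem_graded
  simp only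
  linarith

theorem dtheta_mem_graded (i : Fin 6) {k : ℤ} {x : Fun} (hx : x ∈ graded k) :
    dtheta i x ∈ graded (k - 1) := by
  refine graded_induct (P := (graded (k - 1)).comap (dtheta i)) hx fun m hm => ?_
  change dtheta i (mon m) ∈ graded (k - 1)
  simp only [dtheta, mon, Finsupp.linearCombination_single, one_smul]
  split_ifs with hi
  · apply single_mem_graded
    have := Finset.card_erase_add_one hi
    simp only
    omega
  · exact zero_mem _

theorem parityInv_mem_graded {k : ℤ} {x : Fun} (hx : x ∈ graded k) : parityInv x ∈ graded k := by
  refine graded_induct (P := (graded k).comap parityInv) hx fun m hm => ?_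
  change parityInv (mon m) ∈ graded k
  simp only [parityInv, mon, Finsupp.linearCombination_single, one_smul]
  exact single_mem_graded hm

theorem twoSubEuler_mem_graded {k : ℤ} {x : Fun} (hx : x ∈ graded k) :
    twoSubEuler x ∈ graded k := by
  refine graded_induct (P := (graded k).comap twoSubEuler) hx fun m hm => ?_
  change (2 : ℂ) • mon m - euler (mon m) ∈ graded k
  simp only [euler, mon, Finsupp.linearCombination_single, one_smul]
  exact sub_mem (Submodule.smul_mem _ _ (single_mem_graded hm)) (single_mem_graded hm)

theorem bracket_mem_graded {k l : ℤ} {x y : Fun} (hx : x ∈ graded k) (hy : y ∈ graded l) :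
    bracket x y ∈ graded (k + l - 2) := by
  have h1 := mul_mem_graded (twoSubEuler_mem_graded hx) (dt_mem_graded hy)
  have h2 := mul_mem_graded (dt_mem_graded hx) (twoSubEuler_mem_graded hy)
  have h3 : ∀ i j : Fin 6, mul (dtheta i (parityInv x)) (dtheta j y) ∈ graded (k + l - 2) := by
    intro i j
    have := mul_mem_graded (dtheta_mem_graded i (parityInv_mem_graded hx)) (dtheta_mem_graded j hy)
    convert this using 2
    ring
  have e1 : k + (l - 2) = k + l - 2 := by ring
  have e2 : k - 2 + l = k + l - 2 := by ring
  rw [e1] at h1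
  rw [e2] at h2
  simp only [bracket, poisson, LinearMap.sub_apply, LinearMap.neg_apply, LinearMap.sum_apply,
    LinearMap.add_apply, LinearMap.compl₁₂_apply, LinearMap.comp_apply]
  exact sub_mem (sub_mem h1 h2) (neg_mem (sum_mem fun j _ => add_mem (h3 _ _) (h3 _ _)))

theorem ι_mem_leftIdeal {N : ℕ} {k : ℤ} (hk : (N : ℤ) + 2 ≤ k) {x : Fun} (hx : x ∈ graded k) :
    ι x ∈ leftIdeal N := by
  refine graded_induct (P := ((leftIdeal N).restrictScalars ℂ).comap ι) hx fun m hm => ?_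
  exact Ideal.subset_span ⟨m, by unfold deg; omega, rfl⟩

theorem mon_mem_homog (m : Mon) : mon m ∈ homog (m.2.card : ZMod 2) :=
  Finsupp.single_mem_supported ℂ 1 rfl

theorem ι_mul_ι {p q : ZMod 2} {x y : Fun} (hx : x ∈ homog p) (hy : y ∈ homog q) :
    ι x * ι y = koszul p q • (ι y * ι x) + ι (bracket x y) := by
  have h := RingQuot.mkAlgHom_rel ℂ (Rel.of p q x y hx hy)
  rw [map_sub, map_smul, map_mul, map_mul] at h
  exact sub_eq_iff_eq_add'.1 h

theorem leftIdeal_mul_mon (n : Mon) (N : ℕ) :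
    ∃ M : ℕ, ∀ a ∈ leftIdeal M, a * ι (mon n) ∈ leftIdeal N := by
  refine ⟨N + (deg n).natAbs, fun a ha => ?_⟩
  induction ha using Submodule.span_induction with
  | mem u hu =>
    obtain ⟨m, hm, rfl⟩ := hu
    rw [ι_mul_ι (mon_mem_homog m) (mon_mem_homog n)]
    rw [Nat.cast_add] at hm
    refine add_mem ?_ ?_
    · rw [← smul_mul_assoc]
      exact Ideal.mul_mem_left _ _ (Ideal.subset_span ⟨m, by omega, rfl⟩)
    · exact ι_mem_leftIdeal (by omega) (bracket_mem_graded (mon_mem_graded m) (mon_mem_graded n))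
  | zero => rw [zero_mul]; exact zero_mem _
  | add u v _ _ hu hv => rw [add_mul]; exact add_mem hu hv
  | smul c u _ hu => rw [smul_eq_mul, mul_assoc]; exact Ideal.mul_mem_left _ _ hu

theorem leftIdeal_mul (x : U) :
    ∀ N : ℕ, ∃ M : ℕ, ∀ a ∈ leftIdeal M, a * x ∈ leftIdeal N := by
  have hadd : ∀ x y : U, (∀ N : ℕ, ∃ M : ℕ, ∀ a ∈ leftIdeal M, a * x ∈ leftIdeal N) →
      (∀ N : ℕ, ∃ M : ℕ, ∀ a ∈ leftIdeal M, a * y ∈ leftIdeal N) →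
      ∀ N : ℕ, ∃ M : ℕ, ∀ a ∈ leftIdeal M, a * (x + y) ∈ leftIdeal N := by
    intro x y hx hy N
    obtain ⟨M, hM⟩ := hx N
    obtain ⟨M', hM'⟩ := hy N
    refine ⟨max M M', fun a ha => ?_⟩
    rw [mul_add]
    exact add_mem (hM a (leftIdeal_anti (le_max_left _ _) ha))
      (hM' a (leftIdeal_anti (le_max_right _ _) ha))
  have hmul : ∀ x y : U, (∀ N : ℕ, ∃ M : ℕ, ∀ a ∈ leftIdeal M, a * x ∈ leftIdeal N) →
      (∀ N : ℕ, ∃ M : ℕ, ∀ a ∈ leftIdeal M, a * y ∈ leftIdeal N) →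
      ∀ N : ℕ, ∃ M : ℕ, ∀ a ∈ leftIdeal M, a * (x * y) ∈ leftIdeal N := by
    intro x y hx hy N
    obtain ⟨M, hM⟩ := hy N
    obtain ⟨M', hM'⟩ := hx M
    refine ⟨M', fun a ha => ?_⟩
    rw [← mul_assoc]
    exact hM _ (hM' a ha)
  have halg : ∀ c : ℂ, ∀ N : ℕ, ∃ M : ℕ, ∀ a ∈ leftIdeal M, a * algebraMap ℂ U c ∈ leftIdeal N := by
    intro c N
    refine ⟨N, fun a ha => ?_⟩
    rw [← Algebra.commutes]
    exact Ideal.mul_mem_left _ _ ha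
  have hι : ∀ y : Fun, ∀ N : ℕ, ∃ M : ℕ, ∀ a ∈ leftIdeal M, a * ι y ∈ leftIdeal N := by
    intro y
    induction y using Finsupp.induction_linear with
    | zero => intro N; exact ⟨N, fun a ha => by rw [map_zero, mul_zero]; exact zero_mem _⟩
    | add f g hf hg => rw [map_add]; exact hadd _ _ hf hg
    | single m c =>
      have e : ι (Finsupp.single m c) = algebraMap ℂ U c * ι (mon m) := by
        rw [← Algebra.smul_def, ← map_smul, mon, Finsupp.smul_single, smul_eq_mul, mul_one]
      rw [e]
      exact hmul _ _ (halg c) (leftIdeal_mul_mon m)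
  obtain ⟨z, rfl⟩ := RingQuot.mkAlgHom_surjective ℂ Rel x
  induction z using TensorAlgebra.induction with
  | algebraMap r =>
    rw [AlgHom.commutes]
    exact halg r
  | ι y => exact hι y
  | mul a b ha hb => rw [map_mul]; exact hmul _ _ ha hb
  | add a b ha hb => rw [map_add]; exact hadd _ _ ha hb

theorem leftIdeal_basis : RingSubgroupsBasis fun N : ℕ => (leftIdeal N).toAddSubgroup where
  inter i j := ⟨max i j, le_inf (leftIdeal_anti (le_max_left _ _))
    (leftIdeal_anti (le_max_right _ _))⟩
  mul i := ⟨i, by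
    rintro _ ⟨a, _, b, hb, rfl⟩
    exact Ideal.mul_mem_left _ a hb⟩
  leftMul x i := ⟨i, fun _ hb => Ideal.mul_mem_left _ x hb⟩
  rightMul x i := leftIdeal_mul x i

/-! ## The completed enveloping algebra -/

/-- The topology of the enveloping algebra: the left ideals generated by the elements of degree
at least `N` are a basis of neighbourhoods of zero. -/
instance : TopologicalSpace U := leftIdeal_basis.topology

instance : IsTopologicalRing U := leftIdeal_basis.toRingFilterBasis.isTopologicalRing

instance : UniformSpace U := IsTopologicalAddGroup.rightUniformSpace U

instance : IsUniformAddGroup U := isUniformAddGroup_of_addCommGroup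

/-- The completed enveloping algebra, a topological ring: the inverse limit over `N` of the
quotients of the enveloping algebra by the left ideals generated by the elements of degree at
least `N`. -/
abbrev CompletedU : Type := UniformSpace.Completion U

/-- The canonical map from the enveloping algebra to its completion. -/
def toCompleted : U →+* CompletedU := UniformSpace.Completion.coeRingHom

end ContactK16

end

/-!
The formal sum `Ω = ∑ K_m^* K_m` over all monomials is invariant because the form is, but it does
not converge. Formally, moving the factor of positive weight to the right turns it into linear
terms plus twice the sum of the `φ(m) K_m^* K_m`, where `φ` is `1`, `1/2` or `0` when the weight
of `m` is positive, zero or negative; the eight monomials of weight zero account for `∑ H_i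
H_i^*`. The function `φ` satisfies `φ(m) + φ(m') = 1` for the complementary monomial `m'`, as `m'`
has the opposite weight.

The commutator of `K_g` with `∑ ψ(m) K_m^* K_m`, for a weight function `ψ` with finite support, is
a sum over pairs `(n, m)` of `ψ(n) - ψ(m)` times a quadratic term, by invariance
(`commutator_sum`). For `φ` cut off at a high degree, the pairs near the cutoff give elements of a
small left ideal. The other pairs straddle weight zero, so they are finitely many, and the
involution `(n, m) ↦ (m', n')` exchanges the two orderings of the same product up to sign
(`adCoeff_smul_add_compl`). Hence their sum is an element of the Lie superalgebra, called
`anomaly` below (up to a factor), and `C₂` commutes with `K_g` as soon as the bracket of `K_g`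
with its linear part `4 H₅ + 2 H₆ - 4 H₈` cancels the anomaly.

The centralizer of `C₂` is closed under the bracket, so it suffices to treat generators. The odd
coordinates, `t ^ 3` and `t ^ (-1)` generate (`mon_mem_of_generators`), and for these eight
elements the cancellation is a finite computation with integer coefficients. As the completion is
nonarchimedean, the Casimir sum converges because its terms tend to zero, and an element commuting
with the dense image of `U` is central.

The invariance of the form is integration by parts: the residue kills `∂/∂t` and `∂/∂θ_i`, and
`Res (E f) = 6 Res f` (`form_bracket`).
-/

noncomputable section

namespace ContactK16

/-! ### Monomials -/

theorem single_eq_smul_mon (m : Mon) (c : ℂ) : Finsupp.single m c = c • mon m := by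
  rw [mon, Finsupp.smul_single, smul_eq_mul, mul_one]

@[elab_as_elim]
theorem fun_induction {P : Fun → Prop} (f : Fun) (zero : P 0) (add : ∀ f g, P f → P g → P (f + g))
    (smul : ∀ (c : ℂ) m, P (c • mon m)) : P f := by
  induction f using Finsupp.induction_linear with
  | zero => exact zero
  | add f g hf hg => exact add f g hf hg
  | single m c => rw [single_eq_smul_mon]; exact smul c m

/-- The sign in `∂_i θ_S = ± θ_{S \ {i}}`; it is `0` when `i` is not in `S`. -/
def dsign (i : Fin 6) (S : Finset (Fin 6)) : ℤ :=
  if i ∈ S then (-1) ^ (S.filter (fun j => j < i)).card else 0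

theorem mul_mon (m n : Mon) :
    mul (mon m) (mon n) = (mulSign m.2 n.2 : ℂ) • mon (m.1 + n.1, m.2 ∪ n.2) := by
  simp [mul, mon]

theorem dt_mon (m : Mon) : dt (mon m) = (m.1 : ℂ) • mon (m.1 - 1, m.2) := by
  simp [dt, mon]

theorem dtheta_mon (i : Fin 6) (m : Mon) :
    dtheta i (mon m) = (dsign i m.2 : ℂ) • mon (m.1, m.2.erase i) := by
  by_cases h : i ∈ m.2 <;> simp [dtheta, mon, dsign, h]

theorem euler_mon (m : Mon) : euler (mon m) = (m.2.card : ℂ) • mon m := by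
  simp [euler, mon]

theorem parityInv_mon (m : Mon) : parityInv (mon m) = ((-1) ^ m.2.card : ℂ) • mon m := by
  simp [parityInv, mon]

theorem twoSubEuler_mon (m : Mon) : twoSubEuler (mon m) = (2 - m.2.card : ℂ) • mon m := by
  simp [twoSubEuler, euler_mon, sub_smul]

/-- The sum over `j` of the two terms of the Poisson bracket is a sum over all six odd coordinates,
as `i ↦ i.rev` exchanges `ξ_j` and `η_j`. -/
theorem sum_xi_eta {M : Type*} [AddCommMonoid M] (F : Fin 6 → Fin 6 → M) :
    ∑ j : Fin 3, (F (xi j) (eta j) + F (eta j) (xi j)) = ∑ i : Fin 6, F i i.rev := by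
  rw [Fin.sum_univ_three, Fin.sum_univ_six]
  change F 0 5 + F 5 0 + (F 1 4 + F 4 1) + (F 2 3 + F 3 2) =
    F 0 5 + F 1 4 + F 2 3 + F 3 2 + F 4 1 + F 5 0
  abel

theorem bracket_apply (f g : Fun) :
    bracket f g = mul (twoSubEuler f) (dt g) - mul (dt f) (twoSubEuler g) +
      ∑ i : Fin 6, mul (dtheta i (parityInv f)) (dtheta i.rev g) := by
  rw [← sum_xi_eta fun i j => mul (dtheta i (parityInv f)) (dtheta j g)]
  simp [bracket, poisson, LinearMap.sum_apply]

/-- The coefficient in `bracket (t ^ a * θ_S) (t ^ b * θ_T)` of the term of the Poisson part that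
removes `i` from `S` and the dual index `i.rev` from `T`. -/
def poissonCoeff (S T : Finset (Fin 6)) (i : Fin 6) : ℤ :=
  (-1) ^ S.card * dsign i S * dsign i.rev T * mulSign (S.erase i) (T.erase i.rev)

/-- The bracket of monomials: the first coefficient is that of `t ^ (a + b - 1)`, the others are
those of `t ^ (a + b)`. -/
theorem bracket_mon (m n : Mon) :
    bracket (mon m) (mon n) =
      ((((2 - m.2.card) * n.1 - m.1 * (2 - n.2.card)) * mulSign m.2 n.2 : ℤ) : ℂ) •
        mon (m.1 + n.1 - 1, m.2 ∪ n.2) +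
      ∑ i : Fin 6, (poissonCoeff m.2 n.2 i : ℂ) •
        mon (m.1 + n.1, m.2.erase i ∪ n.2.erase i.rev) := by
  rw [bracket_apply]
  congr 1
  · rw [twoSubEuler_mon, twoSubEuler_mon, dt_mon, dt_mon]
    simp only [map_smul, LinearMap.smul_apply, mul_mon]
    rw [show m.1 + (n.1 - 1) = m.1 + n.1 - 1 by ring, show m.1 - 1 + n.1 = m.1 + n.1 - 1 by ring]
    simp only [smul_smul, ← sub_smul]
    congr 1
    push_cast
    ring
  · refine Finset.sum_congr rfl fun i _ => ?_
    rw [parityInv_mon, dtheta_mon, poissonCoeff]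
    simp only [map_smul, LinearMap.smul_apply, mul_mon, dtheta_mon, smul_smul]
    congr 1
    push_cast
    ring

/-! ### The signs -/

/-- The number of inversions between `S` and `T`, which gives the sign of `θ_S θ_T`. -/
def invCount (S T : Finset (Fin 6)) : ℕ := ((S ×ˢ T).filter (fun p => p.2 < p.1)).card

theorem mulSign_of_disjoint {S T : Finset (Fin 6)} (h : Disjoint S T) :
    mulSign S T = (-1) ^ invCount S T := if_pos h

theorem mulSign_of_not_disjoint {S T : Finset (Fin 6)} (h : ¬ Disjoint S T) :
    mulSign S T = 0 := if_neg h

theorem mulSign_eq_zero_iff {S T : Finset (Fin 6)} : mulSign S T = 0 ↔ ¬ Disjoint S T := by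
  by_cases h : Disjoint S T
  · simp [mulSign_of_disjoint h, h]
  · simp [mulSign_of_not_disjoint h, h]

theorem invCount_eq_sum (S T : Finset (Fin 6)) :
    invCount S T = ∑ p ∈ S, ∑ q ∈ T, if q < p then 1 else 0 := by
  rw [invCount, Finset.card_filter, Finset.sum_product]

theorem invCount_union_left {S T : Finset (Fin 6)} (h : Disjoint S T) (R : Finset (Fin 6)) :
    invCount (S ∪ T) R = invCount S R + invCount T R := by
  simp only [invCount_eq_sum, Finset.sum_union h]

theorem invCount_union_right (S : Finset (Fin 6)) {T R : Finset (Fin 6)} (h : Disjoint T R) :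
    invCount S (T ∪ R) = invCount S T + invCount S R := by
  simp only [invCount_eq_sum, Finset.sum_union h, Finset.sum_add_distrib]

theorem invCount_add_swap {S T : Finset (Fin 6)} (h : Disjoint S T) :
    invCount S T + invCount T S = S.card * T.card := by
  rw [invCount_eq_sum, invCount_eq_sum, Finset.sum_comm (s := T), ← Finset.sum_add_distrib,
    Finset.card_eq_sum_ones S, Finset.sum_mul]
  refine Finset.sum_congr rfl fun p hp => ?_
  rw [← Finset.sum_add_distrib, Finset.card_eq_sum_ones T, Finset.mul_sum]
  refine Finset.sum_congr rfl fun q hq => ?_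
  have : p ≠ q := fun e => Finset.disjoint_left.1 h hp (e ▸ hq)
  rcases lt_or_gt_of_ne this with h | h <;> simp [h, h.not_gt]

theorem invCount_insert_left {i : Fin 6} {S : Finset (Fin 6)} (h : i ∉ S) (T : Finset (Fin 6)) :
    invCount (insert i S) T = (T.filter (· < i)).card + invCount S T := by
  rw [invCount_eq_sum, invCount_eq_sum, Finset.sum_insert h, Finset.card_filter]

theorem invCount_insert_right {i : Fin 6} {T : Finset (Fin 6)} (S : Finset (Fin 6)) (h : i ∉ T) :
    invCount S (insert i T) = (S.filter (i < ·)).card + invCount S T := by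
  rw [invCount_eq_sum, invCount_eq_sum, Finset.card_filter, ← Finset.sum_add_distrib]
  exact Finset.sum_congr rfl fun p _ => Finset.sum_insert h

theorem card_filter_lt_add_gt {i : Fin 6} {S : Finset (Fin 6)} (h : i ∉ S) :
    (S.filter (· < i)).card + (S.filter (i < ·)).card = S.card := by
  rw [Finset.card_filter, Finset.card_filter, ← Finset.sum_add_distrib, Finset.card_eq_sum_ones]
  refine Finset.sum_congr rfl fun p hp => ?_
  have : p ≠ i := fun e => h (e ▸ hp)
  rcases lt_or_gt_of_ne this with h | h <;> simp [h, h.not_gt]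

theorem mulSign_swap (S T : Finset (Fin 6)) :
    mulSign S T = (-1) ^ (S.card * T.card) * mulSign T S := by
  by_cases h : Disjoint S T
  · rw [mulSign_of_disjoint h, mulSign_of_disjoint h.symm, ← invCount_add_swap h, pow_add,
      mul_assoc, ← mul_pow]
    simp
  · rw [mulSign_of_not_disjoint h, mulSign_of_not_disjoint fun h' => h h'.symm, mul_zero]

/-- The associativity of the product of odd monomials. -/
theorem mulSign_assoc (S T R : Finset (Fin 6)) :
    mulSign S T * mulSign (S ∪ T) R = mulSign T R * mulSign S (T ∪ R) := by
  by_cases hST : Disjoint S T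
  · by_cases hTR : Disjoint T R
    · by_cases hSR : Disjoint S R
      · rw [mulSign_of_disjoint hST, mulSign_of_disjoint hTR,
          mulSign_of_disjoint (Finset.disjoint_union_left.2 ⟨hSR, hTR⟩),
          mulSign_of_disjoint (Finset.disjoint_union_right.2 ⟨hST, hSR⟩),
          invCount_union_left hST, invCount_union_right S hTR]
        ring
      · rw [mulSign_of_not_disjoint (S := S ∪ T) fun h => hSR (Finset.disjoint_union_left.1 h).1,
          mulSign_of_not_disjoint (S := S) (T := T ∪ R)
            fun h => hSR (Finset.disjoint_union_right.1 h).2, mul_zero, mul_zero]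
    · rw [mulSign_of_not_disjoint hTR,
        mulSign_of_not_disjoint (S := S ∪ T) fun h => hTR (Finset.disjoint_union_left.1 h).2,
        mul_zero, zero_mul]
  · rw [mulSign_of_not_disjoint hST,
      mulSign_of_not_disjoint (S := S) (T := T ∪ R)
        fun h => hST (Finset.disjoint_union_right.1 h).1, mul_zero, zero_mul]

theorem dsign_of_notMem {i : Fin 6} {S : Finset (Fin 6)} (h : i ∉ S) : dsign i S = 0 := if_neg h

theorem dsign_insert (i : Fin 6) (S : Finset (Fin 6)) :
    dsign i (insert i S) = (-1) ^ (S.filter (· < i)).card := by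
  rw [dsign, if_pos (Finset.mem_insert_self i S), Finset.filter_insert, if_neg (lt_irrefl i)]

/-- The Leibniz rule for `∂_i (θ_S θ_T)` when only the first factor contains `θ_i`. -/
theorem dsign_union_left {i : Fin 6} {S T : Finset (Fin 6)} (hS : i ∉ S) (hT : i ∉ T)
    (h : Disjoint S T) :
    mulSign (insert i S) T * dsign i (insert i S ∪ T) = dsign i (insert i S) * mulSign S T := by
  rw [mulSign_of_disjoint (Finset.disjoint_insert_left.2 ⟨hT, h⟩), mulSign_of_disjoint h,
    Finset.insert_union, dsign_insert, dsign_insert, invCount_insert_left hS,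
    Finset.filter_union, Finset.card_union_of_disjoint
      (Finset.disjoint_filter_filter h)]
  have : ((-1 : ℤ) ^ (T.filter (· < i)).card) * (-1) ^ (T.filter (· < i)).card = 1 := by
    rw [← mul_pow]; simp
  linear_combination (-1) ^ (S.filter (· < i)).card * (-1) ^ invCount S T * this

/-- The Leibniz rule for `∂_i (θ_S θ_T)` when only the second factor contains `θ_i`. -/
theorem dsign_union_right {i : Fin 6} {S T : Finset (Fin 6)} (hS : i ∉ S) (hT : i ∉ T)
    (h : Disjoint S T) :
    mulSign S (insert i T) * dsign i (S ∪ insert i T) =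
      (-1) ^ S.card * (dsign i (insert i T) * mulSign S T) := by
  rw [mulSign_of_disjoint (Finset.disjoint_insert_right.2 ⟨hS, h⟩), mulSign_of_disjoint h,
    Finset.union_insert, dsign_insert, dsign_insert,
    invCount_insert_right S hT, Finset.filter_union, Finset.card_union_of_disjoint
      (Finset.disjoint_filter_filter h), ← card_filter_lt_add_gt hS]
  ring

/-- The Leibniz rule for `∂_i (θ_S θ_T)` when both factors contain `θ_i`, so that the product is
zero. -/
theorem dsign_mul_both {i : Fin 6} {S T : Finset (Fin 6)} (hS : i ∉ S) (hT : i ∉ T)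
    (h : Disjoint S T) :
    dsign i (insert i S) * mulSign S (insert i T) +
      (-1) ^ (insert i S).card * (dsign i (insert i T) * mulSign (insert i S) T) = 0 := by
  rw [mulSign_of_disjoint (Finset.disjoint_insert_right.2 ⟨hS, h⟩),
    mulSign_of_disjoint (Finset.disjoint_insert_left.2 ⟨hT, h⟩), dsign_insert, dsign_insert,
    invCount_insert_left hS, invCount_insert_right S hT, Finset.card_insert_of_notMem hS,
    ← card_filter_lt_add_gt hS]
  have : ((-1 : ℤ) ^ (T.filter (· < i)).card) * (-1) ^ (T.filter (· < i)).card = 1 := by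
    rw [← mul_pow]; simp
  rw [pow_add, pow_add, pow_add, pow_add]
  linear_combination (-(-1) ^ (S.filter (· < i)).card * (-1) ^ (S.filter (i < ·)).card *
    (-1) ^ invCount S T) * this

/-- The odd partial derivatives anticommute. -/
theorem dsign_swap {i j : Fin 6} (_h : i ≠ j) (S : Finset (Fin 6)) :
    dsign j S * dsign i (S.erase j) = -(dsign i S * dsign j (S.erase i)) := by
  revert i j S
  decide +kernel

/-! ### Differential calculus on the supercircle -/

theorem fun_mul_assoc (f g h : Fun) : mul (mul f g) h = mul f (mul g h) := by
  induction f using fun_induction with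
  | zero => simp
  | add f f' hf hf' => simp [hf, hf']
  | smul c m =>
  induction g using fun_induction with
  | zero => simp
  | add f f' hf hf' => simp only [map_add, LinearMap.add_apply, hf, hf']
  | smul c' n =>
  induction h using fun_induction with
  | zero => simp
  | add f f' hf hf' => simp only [map_add, hf, hf']
  | smul c'' k =>
  simp only [map_smul, LinearMap.smul_apply, mul_mon, smul_smul, add_assoc, Finset.union_assoc]
  congr 1
  have := congrArg (Int.cast : ℤ → ℂ) (mulSign_assoc m.2 n.2 k.2)
  push_cast at this
  linear_combination c * c' * c'' * this

theorem dt_mul (f g : Fun) : dt (mul f g) = mul (dt f) g + mul f (dt g) := by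
  induction f using fun_induction with
  | zero => simp
  | add f f' hf hf' => simp only [map_add, LinearMap.add_apply, hf, hf']; abel
  | smul c m =>
  induction g using fun_induction with
  | zero => simp
  | add f f' hf hf' => simp only [map_add, hf, hf']; abel
  | smul c' n =>
  simp only [map_smul, LinearMap.smul_apply, mul_mon, dt_mon]
  rw [show m.1 - 1 + n.1 = m.1 + n.1 - 1 by ring, show m.1 + (n.1 - 1) = m.1 + n.1 - 1 by ring]
  push_cast
  module

theorem euler_mul (f g : Fun) : euler (mul f g) = mul (euler f) g + mul f (euler g) := by
  induction f using fun_induction with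
  | zero => simp
  | add f f' hf hf' => simp only [map_add, LinearMap.add_apply, hf, hf']; abel
  | smul c m =>
  induction g using fun_induction with
  | zero => simp
  | add f f' hf hf' => simp only [map_add, hf, hf']; abel
  | smul c' n =>
  simp only [map_smul, LinearMap.smul_apply, mul_mon, euler_mon]
  by_cases h : Disjoint m.2 n.2
  · rw [Finset.card_union_of_disjoint h]
    push_cast
    module
  · simp [mulSign_of_not_disjoint h]

theorem neg_one_pow_mul_self (k : ℕ) : ((-1 : ℂ) ^ k) * (-1) ^ k = 1 := by
  rw [← mul_pow]; simp

theorem parityInv_parityInv (f : Fun) : parityInv (parityInv f) = f := by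
  induction f using fun_induction with
  | zero => simp
  | add f f' hf hf' => simp only [map_add, hf, hf']
  | smul c m =>
  simp only [map_smul, parityInv_mon, smul_smul, mul_assoc, neg_one_pow_mul_self, mul_one]

theorem dtheta_parityInv (i : Fin 6) (f : Fun) :
    dtheta i (parityInv f) = -parityInv (dtheta i f) := by
  induction f using fun_induction with
  | zero => simp
  | add f f' hf hf' => simp only [map_add, hf, hf']; abel
  | smul c m =>
  simp only [map_smul, parityInv_mon, dtheta_mon]
  by_cases h : i ∈ m.2
  · rw [← Finset.card_erase_add_one h, pow_succ]
    module
  · simp [dsign_of_notMem h]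

theorem dtheta_anticomm (i j : Fin 6) (f : Fun) :
    dtheta i (dtheta j f) = -dtheta j (dtheta i f) := by
  induction f using fun_induction with
  | zero => simp
  | add f f' hf hf' => simp only [map_add, hf, hf']; abel
  | smul c m =>
  simp only [map_smul, dtheta_mon, smul_smul]
  by_cases h : i = j
  · subst h
    simp [dsign_of_notMem]
  · have := congrArg (Int.cast : ℤ → ℂ) (dsign_swap h m.2)
    push_cast at this
    rw [mul_assoc, this, Finset.erase_right_comm, ← neg_smul]
    congr 1
    ring

/-- The odd partial derivatives satisfy the Leibniz rule with the sign `(-1) ^ p(f)`. -/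
theorem dtheta_mul (i : Fin 6) (f g : Fun) :
    dtheta i (mul f g) = mul (dtheta i f) g + mul (parityInv f) (dtheta i g) := by
  induction f using fun_induction with
  | zero => simp
  | add f f' hf hf' => simp only [map_add, LinearMap.add_apply, hf, hf']; abel
  | smul c m =>
  induction g using fun_induction with
  | zero => simp
  | add f f' hf hf' => simp only [map_add, hf, hf']; abel
  | smul c' n =>
  obtain ⟨a, S⟩ := m
  obtain ⟨b, T⟩ := n
  simp only [map_smul, LinearMap.smul_apply, mul_mon, dtheta_mon, parityInv_mon, smul_smul]
  by_cases hS : i ∈ S <;> by_cases hT : i ∈ T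
  · obtain ⟨S, hS', rfl⟩ : ∃ S', i ∉ S' ∧ S = insert i S' :=
      ⟨S.erase i, Finset.notMem_erase i S, (Finset.insert_erase hS).symm⟩
    obtain ⟨T, hT', rfl⟩ : ∃ T', i ∉ T' ∧ T = insert i T' :=
      ⟨T.erase i, Finset.notMem_erase i T, (Finset.insert_erase hT).symm⟩
    rw [mulSign_of_not_disjoint (by simp), Finset.erase_insert hS', Finset.erase_insert hT',
      Finset.insert_union, Finset.insert_union, Finset.union_insert, ← add_smul]
    by_cases h : Disjoint S T
    · have := congrArg (Int.cast : ℤ → ℂ) (dsign_mul_both hS' hT' h)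
      push_cast at this
      symm
      convert zero_smul ℂ _
      · linear_combination c * c' * this
      · simp
    · rw [mulSign_of_not_disjoint fun h' => h (Finset.disjoint_insert_left.1 h').2,
        mulSign_of_not_disjoint fun h' => h (Finset.disjoint_insert_right.1 h').2]
      simp
  · obtain ⟨S, hS', rfl⟩ : ∃ S', i ∉ S' ∧ S = insert i S' :=
      ⟨S.erase i, Finset.notMem_erase i S, (Finset.insert_erase hS).symm⟩
    rw [Finset.erase_insert hS', dsign_of_notMem hT]
    by_cases h : Disjoint S T
    · have := congrArg (Int.cast : ℤ → ℂ) (dsign_union_left hS' hT h)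
      push_cast at this
      rw [Finset.insert_union, Finset.erase_insert (by simp [hS', hT]), ← Finset.insert_union]
      simp only [Int.cast_zero, zero_mul, mul_zero, zero_smul, add_zero]
      congr 1
      linear_combination c * c' * this
    · rw [mulSign_of_not_disjoint fun h' => h (Finset.disjoint_insert_left.1 h').2,
        mulSign_of_not_disjoint h]
      simp
  · obtain ⟨T, hT', rfl⟩ : ∃ T', i ∉ T' ∧ T = insert i T' :=
      ⟨T.erase i, Finset.notMem_erase i T, (Finset.insert_erase hT).symm⟩
    rw [Finset.erase_insert hT', dsign_of_notMem hS]
    by_cases h : Disjoint S T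
    · have := congrArg (Int.cast : ℤ → ℂ) (dsign_union_right hS hT' h)
      push_cast at this
      rw [Finset.union_insert, Finset.erase_insert (by simp [hS, hT']), ← Finset.union_insert]
      simp only [Int.cast_zero, zero_mul, mul_zero, zero_smul, zero_add]
      congr 1
      linear_combination c * c' * this
    · rw [mulSign_of_not_disjoint fun h' => h (Finset.disjoint_insert_right.1 h').2,
        mulSign_of_not_disjoint h]
      simp
  · rw [dsign_of_notMem hS, dsign_of_notMem hT, dsign_of_notMem (by simp [hS, hT])]
    simp

/-! ### The residue and the invariant form -/

theorem res_mon (m : Mon) : res (mon m) = if m = (-1, Finset.univ) then 1 else 0 := by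
  simp [res, mon, Finsupp.single_apply]

theorem res_dt (f : Fun) : res (dt f) = 0 := by
  induction f using fun_induction with
  | zero => simp
  | add f f' hf hf' => simp only [map_add, hf, hf', add_zero]
  | smul c m =>
  rw [map_smul, dt_mon, map_smul, map_smul, res_mon]
  by_cases h : m.1 = 0
  · simp [h]
  · rw [if_neg (fun e => h (by have := congrArg Prod.fst e; simp only at this; omega))]
    simp

theorem res_dtheta (i : Fin 6) (f : Fun) : res (dtheta i f) = 0 := by
  induction f using fun_induction with
  | zero => simp
  | add f f' hf hf' => simp only [map_add, hf, hf', add_zero]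
  | smul c m =>
  rw [map_smul, dtheta_mon, map_smul, map_smul, res_mon, if_neg]
  · simp
  · intro e
    have := congrArg Prod.snd e
    simp only at this
    exact Finset.notMem_erase i m.2 (this ▸ Finset.mem_univ i)

theorem res_euler (f : Fun) : res (euler f) = 6 * res f := by
  induction f using fun_induction with
  | zero => simp
  | add f f' hf hf' => simp only [map_add, hf, hf', mul_add]
  | smul c m =>
  rw [map_smul, euler_mon, map_smul, map_smul, map_smul, res_mon]
  split_ifs with h
  · subst h
    simp
    ring
  · simp

theorem dt_euler (f : Fun) : dt (euler f) = euler (dt f) := by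
  induction f using fun_induction with
  | zero => simp
  | add f f' hf hf' => simp only [map_add, hf, hf']
  | smul c m =>
    simp only [map_smul, euler_mon, dt_mon]
    module

/-- Integration by parts of the Poisson part of the bracket. -/
theorem res_poisson (f g h : Fun) :
    ∑ i : Fin 6, res (mul (mul (dtheta i (parityInv f)) (dtheta i.rev g)) h) =
      ∑ i : Fin 6, res (mul f (mul (dtheta i (parityInv g)) (dtheta i.rev h))) := by
  have key : ∀ i : Fin 6, res (mul (mul (dtheta i (parityInv f)) (dtheta i.rev g)) h) =
      res (mul f (mul (dtheta i.rev (parityInv g)) (dtheta i h))) -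
        res (mul f (mul (dtheta i (dtheta i.rev g)) h)) := by
    intro i
    have := res_dtheta i (mul (mul (parityInv f) (dtheta i.rev g)) h)
    simp only [dtheta_mul, parityInv_parityInv, map_add, fun_mul_assoc] at this
    rw [dtheta_parityInv i.rev g]
    simp only [map_neg, LinearMap.neg_apply, fun_mul_assoc]
    linear_combination this
  -- `∑ ∂_i ∂_{i.rev} g = 0` because the odd derivatives anticommute
  have anti : ∑ i : Fin 6, res (mul f (mul (dtheta i (dtheta i.rev g)) h)) = 0 := by
    have e : ∑ i : Fin 6, res (mul f (mul (dtheta i (dtheta i.rev g)) h)) =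
        -∑ i : Fin 6, res (mul f (mul (dtheta i (dtheta i.rev g)) h)) := by
      rw [← Finset.sum_neg_distrib, ← Equiv.sum_comp Fin.revPerm]
      refine Finset.sum_congr rfl fun i _ => ?_
      rw [Fin.revPerm_apply, Fin.rev_rev, dtheta_anticomm]
      simp
    linear_combination e / 2
  rw [Finset.sum_congr rfl fun i _ => key i, Finset.sum_sub_distrib, anti, sub_zero,
    ← Equiv.sum_comp Fin.revPerm]
  refine Finset.sum_congr rfl fun i _ => ?_
  rw [Fin.revPerm_apply, Fin.rev_rev]

theorem form_apply (f g : Fun) : form f g = res (mul f g) := rfl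

/-- Invariance of the form, by integration by parts: `Res` kills `∂/∂t` and `∂/∂θ_i`, and
`Res ∘ E = 6 Res`. -/
theorem form_bracket (x y z : Fun) : form (bracket x y) z = form x (bracket y z) := by
  simp only [form_apply, bracket_apply, map_add, map_sub, LinearMap.add_apply, LinearMap.sub_apply,
    map_sum, LinearMap.sum_apply, res_poisson]
  congr 1
  have h1 := res_dt (mul x (mul (twoSubEuler y) z))
  have h2 := res_euler (mul x (mul (dt y) z))
  simp only [twoSubEuler, LinearMap.sub_apply, LinearMap.smul_apply, LinearMap.id_apply,
    dt_mul, euler_mul, map_add, map_sub, map_smul, fun_mul_assoc, dt_euler, smul_eq_mul] at h1 h2 ⊢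
  linear_combination (-1 : ℂ) * h1 - h2

/-! ### The dual bases -/

theorem compl_compl_mon (m : Mon) : compl (compl m) = m := by
  simp [compl]

theorem compl_injective : Function.Injective compl :=
  Function.LeftInverse.injective compl_compl_mon

theorem card_compl (m : Mon) : (compl m).2.card = 6 - m.2.card := by
  simp [compl, Finset.card_compl]

theorem card_le_six (m : Mon) : m.2.card ≤ 6 := by
  simpa using Finset.card_le_univ m.2

theorem deg_compl (m : Mon) : deg (compl m) = -deg m := by
  have := card_le_six m
  rw [deg, deg, card_compl]
  simp only [compl]
  push_cast [this]
  ring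

/-- The sign of the value of the form at a monomial and its complement. -/
def dualSign (m : Mon) : ℤ := mulSign m.2 m.2ᶜ

theorem dualSign_eq (m : Mon) : dualSign m = 1 ∨ dualSign m = -1 := by
  rw [dualSign, mulSign_of_disjoint disjoint_compl_right]
  exact neg_one_pow_eq_or ℤ _

theorem dualSign_mul_self (m : Mon) : (dualSign m : ℂ) * dualSign m = 1 := by
  rcases dualSign_eq m with h | h <;> simp [h]

theorem neg_one_pow_card_compl (m : Mon) :
    ((-1) ^ (compl m).2.card : ℂ) = (-1) ^ m.2.card := by
  have h : ((-1) ^ (6 - m.2.card) : ℂ) * (-1) ^ m.2.card = 1 := by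
    rw [← pow_add, Nat.sub_add_cancel (card_le_six m)]
    norm_num
  rw [card_compl]
  linear_combination (-1) ^ m.2.card * h - (-1) ^ (6 - m.2.card) * neg_one_pow_mul_self m.2.card

theorem neg_one_pow_mul_card_compl (k : ℕ) (m : Mon) :
    ((-1) ^ (k * (compl m).2.card) : ℂ) = (-1) ^ (k * m.2.card) := by
  rw [mul_comm, pow_mul, neg_one_pow_card_compl, ← pow_mul, mul_comm]

theorem mul_mon_comm (m n : Mon) :
    mul (mon m) (mon n) = ((-1) ^ (m.2.card * n.2.card) : ℂ) • mul (mon n) (mon m) := by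
  rw [mul_mon, mul_mon, mulSign_swap, smul_smul, add_comm, Finset.union_comm]
  push_cast
  rfl

theorem form_mon_comm (m n : Mon) :
    form (mon m) (mon n) = (-1) ^ (m.2.card * n.2.card) * form (mon n) (mon m) := by
  rw [form_apply, form_apply, mul_mon_comm, map_smul, smul_eq_mul]

theorem form_mon (m n : Mon) :
    form (mon m) (mon n) = if n = compl m then (dualSign m : ℂ) else 0 := by
  rw [form_apply, mul_mon, map_smul, res_mon, smul_eq_mul]
  by_cases hd : Disjoint m.2 n.2
  · by_cases h : n = compl m
    · subst h
      simp [compl, dualSign]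
    · rw [if_neg h, if_neg, mul_zero]
      intro e
      apply h
      simp only [Prod.mk.injEq] at e
      refine Prod.ext (by simp only [compl]; omega) ?_
      exact (IsCompl.compl_eq ⟨hd, codisjoint_iff.2 e.2⟩).symm
  · rw [mulSign_of_not_disjoint hd, if_neg (c := n = compl m)]
    · simp
    · rintro rfl
      exact hd disjoint_compl_right

theorem form_mon_compl (m : Mon) : form (mon m) (mon (compl m)) = dualSign m := by
  rw [form_mon, if_pos rfl]

theorem rightDual_eq (m : Mon) : rightDual m = (dualSign m : ℂ) • mon (compl m) := by
  rw [rightDual, form_mon_compl]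
  rcases dualSign_eq m with h | h <;> simp [h]

theorem dualSign_compl (m : Mon) :
    (dualSign (compl m) : ℂ) = (-1) ^ m.2.card * dualSign m := by
  have := form_mon_comm (compl m) m
  rw [form_mon_compl m, form_mon, if_pos (compl_compl_mon m).symm, mul_comm (compl m).2.card,
    neg_one_pow_mul_card_compl, pow_mul] at this
  rw [this]
  rcases neg_one_pow_eq_or ℂ m.2.card with h | h <;> simp [h]

theorem form_rightDual (m n : Mon) :
    form (mon m) (rightDual n) = if m = n then 1 else 0 := by
  rw [rightDual_eq, map_smul, form_mon, smul_eq_mul]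
  by_cases h : n = m
  · subst h
    simp [dualSign_mul_self]
  · simp [h, Ne.symm h, compl_injective.eq_iff]

/-- The coefficients of an element are its products with the right duals. -/
theorem form_rightDual_apply (f : Fun) (n : Mon) : form f (rightDual n) = f n := by
  induction f using fun_induction with
  | zero => simp
  | add f f' hf hf' => simp only [map_add, LinearMap.add_apply, hf, hf', Finsupp.add_apply]
  | smul c m =>
    rw [map_smul, LinearMap.smul_apply, form_rightDual, mon, Finsupp.smul_apply,
      Finsupp.single_apply]

theorem form_mon_compl_apply (f : Fun) (n : Mon) :
    form f (mon (compl n)) = dualSign n * f n := by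
  rw [← form_rightDual_apply, rightDual_eq, map_smul, smul_eq_mul, ← mul_assoc, dualSign_mul_self,
    one_mul]

theorem form_mon_left (n : Mon) (f : Fun) :
    form (mon n) f = dualSign n * f (compl n) := by
  induction f using fun_induction with
  | zero => simp
  | add f f' hf hf' => simp only [map_add, hf, hf', Finsupp.add_apply, mul_add]
  | smul c m =>
    rw [map_smul, form_mon, mon, Finsupp.smul_apply, Finsupp.single_apply]
    split_ifs <;> simp [mul_comm]

/-! ### Parity -/

theorem koszul_natCast (a b : ℕ) : koszul a b = (-1) ^ (a * b) := by
  rw [koszul, ZMod.val_natCast, ZMod.val_natCast, neg_one_pow_eq_pow_mod_two,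
    neg_one_pow_eq_pow_mod_two (n := a * b), ← Nat.mul_mod]

theorem homog_induct {p : ZMod 2} {P : Submodule ℂ Fun} {x : Fun} (hx : x ∈ homog p)
    (h : ∀ m : Mon, (m.2.card : ZMod 2) = p → mon m ∈ P) : x ∈ P := by
  rw [homog, Finsupp.supported_eq_span_single] at hx
  refine Submodule.span_le.2 ?_ hx
  rintro _ ⟨m, hm, rfl⟩
  exact h m hm

/-- Two bilinear maps that agree on the monomials of parities `p` and `q` agree on the elements
of these parities. -/
theorem homog_ext₂ {M : Type*} [AddCommGroup M] [Module ℂ M] {A B : Fun →ₗ[ℂ] Fun →ₗ[ℂ] M}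
    {p q : ZMod 2} {x y : Fun} (hx : x ∈ homog p) (hy : y ∈ homog q)
    (h : ∀ m n : Mon, (m.2.card : ZMod 2) = p → (n.2.card : ZMod 2) = q →
      A (mon m) (mon n) = B (mon m) (mon n)) : A x y = B x y := by
  refine homog_induct (P := LinearMap.eqLocus (A.flip y) (B.flip y)) hx fun m hm => ?_
  change A (mon m) y = B (mon m) y
  exact homog_induct (P := LinearMap.eqLocus (A (mon m)) (B (mon m))) hy fun n hn => h m n hm hn

theorem form_eq_zero_of_ne {p q : ZMod 2} {x y : Fun} (hx : x ∈ homog p) (hy : y ∈ homog q)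
    (hpq : p ≠ q) : form x y = 0 := by
  refine homog_ext₂ (B := 0) hx hy fun m n hm hn => ?_
  rw [form_mon, if_neg]
  · rfl
  · rintro rfl
    apply hpq
    rw [← hm, ← hn, card_compl, Nat.cast_sub (card_le_six m), eq_sub_iff_add_eq, ← two_mul]
    rw [show (2 : ZMod 2) = 0 from rfl, zero_mul]
    rfl

theorem form_supersymm {p q : ZMod 2} {x y : Fun} (hx : x ∈ homog p) (hy : y ∈ homog q) :
    form x y = koszul p q * form y x := by
  refine homog_ext₂ (B := koszul p q • form.flip) hx hy fun m n hm hn => ?_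
  rw [form_mon_comm, ← hm, ← hn, koszul_natCast]
  rfl

theorem form_nondegenerate : form.Nondegenerate := by
  have key : ∀ x : Fun, (∀ n, form x (mon (compl n)) = 0) → x = 0 := by
    intro x hx
    ext n
    rw [← form_rightDual_apply, rightDual_eq, map_smul, hx, smul_zero]
    rfl
  refine ⟨fun x hx => key x fun n => hx _, fun y hy => ?_⟩
  ext n
  have h := hy (mon (compl n))
  rw [form_mon_left, compl_compl_mon] at h
  rcases dualSign_eq (compl n) with e | e <;> simpa [e] using h

/-- The bracket is super-antisymmetric. -/
theorem bracket_mon_antisymm (m n : Mon) :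
    bracket (mon m) (mon n) = -((-1) ^ (m.2.card * n.2.card) : ℂ) • bracket (mon n) (mon m) := by
  rw [bracket_mon, bracket_mon, smul_add, add_comm n.1, Finset.union_comm n.2, smul_smul,
    Finset.smul_sum, ← Equiv.sum_comp Fin.revPerm]
  congr 1
  · rw [mulSign_swap]
    congr 1
    push_cast
    ring
  · refine Finset.sum_congr rfl fun i _ => ?_
    rw [Fin.revPerm_apply, Fin.rev_rev, Finset.union_comm, smul_smul, poissonCoeff, poissonCoeff,
      Fin.rev_rev]
    congr 1
    by_cases hm : i.rev ∈ m.2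
    · by_cases hn : i ∈ n.2
      · rw [mulSign_swap, ← Finset.card_erase_add_one hm, ← Finset.card_erase_add_one hn]
        push_cast
        have h1 := neg_one_pow_mul_self (n.2.erase i).card
        simp only [pow_add, pow_mul, mul_add, add_mul, mul_one, one_mul, pow_one]
        linear_combination (dsign i.rev m.2 * dsign i n.2 *
          mulSign (n.2.erase i) (m.2.erase i.rev) * (-1) ^ (m.2.erase i.rev).card *
          (-1) ^ ((m.2.erase i.rev).card * (n.2.erase i).card) : ℂ) * h1
      · simp [dsign_of_notMem hn]
    · simp [dsign_of_notMem hm]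

theorem bracket_mon_mem_homog (m n : Mon) :
    bracket (mon m) (mon n) ∈ homog ((m.2.card : ZMod 2) + n.2.card) := by
  have key : ∀ (c : ℤ) (k : Mon), (c ≠ 0 → (k.2.card : ZMod 2) = (m.2.card : ZMod 2) + n.2.card) →
      (c : ℂ) • mon k ∈ homog ((m.2.card : ZMod 2) + n.2.card) := by
    intro c k h
    by_cases hc : c = 0
    · simp [hc]
    · exact Submodule.smul_mem _ _ (h hc ▸ mon_mem_homog k)
  rw [bracket_mon]
  refine add_mem (key _ _ fun h => ?_) (sum_mem fun i _ => key _ _ fun h => ?_)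
  · have hd : Disjoint m.2 n.2 := by
      by_contra hd
      exact h (by rw [mulSign_of_not_disjoint hd, mul_zero])
    simp only [Finset.card_union_of_disjoint hd, Nat.cast_add]
  · have hm : i ∈ m.2 := by
      by_contra hm
      exact h (by simp [poissonCoeff, dsign_of_notMem hm])
    have hn : i.rev ∈ n.2 := by
      by_contra hn
      exact h (by simp [poissonCoeff, dsign_of_notMem hn])
    have hd : Disjoint (m.2.erase i) (n.2.erase i.rev) := by
      by_contra hd
      exact h (by rw [poissonCoeff, mulSign_of_not_disjoint hd, mul_zero])
    rw [← Finset.card_erase_add_one hm, ← Finset.card_erase_add_one hn]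
    simp only [Finset.card_union_of_disjoint hd, Nat.cast_add, Nat.cast_one]
    rw [add_add_add_comm, show (1 + 1 : ZMod 2) = 0 from rfl, add_zero]

/-! ### The weights -/

theorem bracket_mon_singleton (a : ℤ) (i : Fin 6) (n : Mon) :
    bracket (mon (a, {i})) (mon n) =
      (((n.1 - a * (2 - n.2.card)) * mulSign {i} n.2 : ℤ) : ℂ) • mon (a + n.1 - 1, insert i n.2) -
      (dsign i.rev n.2 : ℂ) • mon (a + n.1, n.2.erase i.rev) := by
  rw [bracket_mon, Finset.sum_eq_single i]
  · rw [sub_eq_add_neg (b := (dsign i.rev n.2 : ℂ) • _), ← neg_smul]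
    congr 2
    · norm_num
    · simp [poissonCoeff, dsign, mulSign, Finset.filter_singleton, neg_ite]
    · simp
  · intro j _ hj
    simp [poissonCoeff, dsign_of_notMem (show j ∉ ({i} : Finset (Fin 6)) by simpa using hj)]
  · simp

theorem bracket_mon_empty (a : ℤ) (n : Mon) :
    bracket (mon (a, ∅)) (mon n) =
      ((2 * n.1 - a * (2 - n.2.card) : ℤ) : ℂ) • mon (a + n.1 - 1, n.2) := by
  rw [bracket_mon, Finset.sum_eq_zero]
  · simp [mulSign]
  · intro i _
    simp [poissonCoeff, dsign]

theorem bracket_xi_eta (j : Fin 3) (m : Mon) :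
    bracket (mon (0, {xi j, eta j})) (mon m) = (weight m j.succ : ℂ) • mon m := by
  have h1 : ∀ (j : Fin 3) (T : Finset (Fin 6)) (i : Fin 6),
      poissonCoeff {xi j, eta j} T i ≠ 0 →
        ({xi j, eta j} : Finset (Fin 6)).erase i ∪ T.erase i.rev = T := by
    decide +kernel
  have h2 : ∀ (j : Fin 3) (T : Finset (Fin 6)), ∑ i, poissonCoeff {xi j, eta j} T i =
      (if eta j ∈ T then 1 else 0) - (if xi j ∈ T then 1 else 0) := by
    decide +kernel
  have h3 : ∀ j : Fin 3, ({xi j, eta j} : Finset (Fin 6)).card = 2 := by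
    decide +kernel
  have h4 : ∀ i : Fin 6, (poissonCoeff {xi j, eta j} m.2 i : ℂ) •
      mon (0 + m.1, ({xi j, eta j} : Finset (Fin 6)).erase i ∪ m.2.erase i.rev) =
        (poissonCoeff {xi j, eta j} m.2 i : ℂ) • mon m := by
    intro i
    by_cases h : poissonCoeff {xi j, eta j} m.2 i = 0
    · rw [h, Int.cast_zero, zero_smul, zero_smul]
    · rw [h1 j m.2 i h, zero_add]
  rw [show weight m j.succ = (if eta j ∈ m.2 then 1 else 0) - (if xi j ∈ m.2 then 1 else 0) from
    rfl, ← h2 j m.2, Int.cast_sum, Finset.sum_smul, ← Finset.sum_congr rfl fun i _ => h4 i,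
    bracket_mon, h3]
  norm_num

theorem bracket_diag (m : Mon) (i : Fin 4) :
    bracket (H (diagIdx i)) (mon m) = (weight m i : ℂ) • mon m := by
  refine Fin.cases ?_ (fun j => ?_) i
  · change bracket (mon (1, ∅)) (mon m) = (deg m : ℂ) • mon m
    rw [bracket_mon_empty, deg, add_sub_cancel_left]
    congr 2
    ring
  · rw [← bracket_xi_eta]
    fin_cases j <;> rfl

theorem rightDual_cartanMon (i : Fin 4) :
    rightDual (cartanMon (Fin.castAdd 4 i)) = H (Fin.natAdd 4 i) := by
  have h1 : ∀ i : Fin 4, compl (cartanMon (Fin.castAdd 4 i)) = cartanMon (Fin.natAdd 4 i) := by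
    decide +kernel
  have h2 : ∀ i : Fin 4, dualSign (cartanMon (Fin.castAdd 4 i)) = 1 := by
    decide +kernel
  rw [rightDual_eq, h1, h2, H]
  simp

/-! ### Heights -/

/-- The pairing of the weight with `(27; 9, 3, 1)`. As the last three components of a weight lie in
`{-1, 0, 1}`, its sign is the sign of the weight in the lexicographic order. -/
def height (m : Mon) : ℤ :=
  27 * deg m + 9 * weight m 1 + 3 * weight m 2 + weight m 3

/-- The sign of the weight of a monomial in the lexicographic order. -/
def rootSign (m : Mon) : ℤ := (height m).sign

theorem weight_zero (m : Mon) : weight m 0 = deg m := rfl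

theorem weight_succ (m : Mon) (j : Fin 3) :
    weight m j.succ = (if eta j ∈ m.2 then 1 else 0) - (if xi j ∈ m.2 then 1 else 0) := rfl

theorem weight_succ_mem (m : Mon) (j : Fin 3) :
    -1 ≤ weight m j.succ ∧ weight m j.succ ≤ 1 := by
  rw [weight_succ]
  split_ifs <;> norm_num

theorem weight_compl (m : Mon) (i : Fin 4) : weight (compl m) i = -weight m i := by
  refine Fin.cases (deg_compl m) (fun j => ?_) i
  rw [weight_succ, weight_succ]
  simp only [compl, Finset.mem_compl]
  split_ifs <;> norm_num

theorem height_compl (m : Mon) : height (compl m) = -height m := by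
  simp only [height, weight_compl, deg_compl]
  ring

theorem rootSign_compl (m : Mon) : rootSign (compl m) = -rootSign m := by
  rw [rootSign, height_compl, Int.sign_neg, rootSign]

theorem height_bounds (m : Mon) : 27 * deg m - 13 ≤ height m ∧ height m ≤ 27 * deg m + 13 := by
  have h1 := weight_succ_mem m 0
  have h2 := weight_succ_mem m 1
  have h3 := weight_succ_mem m 2
  simp only [Fin.succ_zero_eq_one, Fin.succ_one_eq_two] at h1 h2
  change -1 ≤ weight m 3 ∧ weight m 3 ≤ 1 at h3
  rw [height]
  omega

theorem rootSign_of_deg_pos {m : Mon} (h : 0 < deg m) : rootSign m = 1 :=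
  Int.sign_eq_one_of_pos (by have := height_bounds m; omega)

theorem rootSign_of_deg_neg {m : Mon} (h : deg m < 0) : rootSign m = -1 :=
  Int.sign_eq_neg_one_of_neg (by have := height_bounds m; omega)

theorem isPositive_iff (m : Mon) : IsPositive m ↔ 0 < height m := by
  have h1 := weight_succ_mem m 0
  have h2 := weight_succ_mem m 1
  have h3 := weight_succ_mem m 2
  simp only [Fin.succ_zero_eq_one, Fin.succ_one_eq_two] at h1 h2
  change -1 ≤ weight m 3 ∧ weight m 3 ≤ 1 at h3
  have h0 := weight_zero m
  have key : IsPositive m ↔ ∃ i : Fin 4, (∀ j < i, 0 = weight m j) ∧ 0 < weight m i := Iff.rfl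
  have key' : IsPositive m ↔ 0 < weight m 0 ∨ (0 = weight m 0 ∧ 0 < weight m 1) ∨
      (0 = weight m 0 ∧ 0 = weight m 1 ∧ 0 < weight m 2) ∨
      (0 = weight m 0 ∧ 0 = weight m 1 ∧ 0 = weight m 2 ∧ 0 < weight m 3) := by
    rw [key]
    constructor
    · rintro ⟨i, h, h'⟩
      fin_cases i
      · exact Or.inl h'
      · exact Or.inr (Or.inl ⟨h 0 (by decide), h'⟩)
      · exact Or.inr (Or.inr (Or.inl ⟨h 0 (by decide), h 1 (by decide), h'⟩))
      · exact Or.inr (Or.inr (Or.inr ⟨h 0 (by decide), h 1 (by decide), h 2 (by decide), h'⟩))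
    · rintro (h | ⟨h, h'⟩ | ⟨h, h', h''⟩ | ⟨h, h', h'', h3⟩)
      · exact ⟨0, fun j hj => absurd hj (by simp), h⟩
      · refine ⟨1, fun j hj => ?_, h'⟩
        fin_cases j <;> simp_all
      · refine ⟨2, fun j hj => ?_, h''⟩
        fin_cases j <;> simp_all
      · refine ⟨3, fun j hj => ?_, h3⟩
        fin_cases j <;> simp_all
  rw [key', height]
  omega

/-- The monomials of weight zero are those of `H₁, …, H₈`. -/
theorem rootSign_eq_zero_iff (m : Mon) : rootSign m = 0 ↔ ∃ i, cartanMon i = m := by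
  constructor
  · intro h
    rw [rootSign, Int.sign_eq_zero_iff_zero] at h
    have h1 := weight_succ_mem m 0
    have h2 := weight_succ_mem m 1
    have h3 := weight_succ_mem m 2
    have hb := height_bounds m
    simp only [Fin.succ_zero_eq_one, Fin.succ_one_eq_two] at h1 h2
    change -1 ≤ weight m 3 ∧ weight m 3 ≤ 1 at h3
    have h0 : deg m = 0 := by omega
    have e3 : ∀ j : Fin 3, (if eta j ∈ m.2 then (1 : ℤ) else 0) -
        (if xi j ∈ m.2 then 1 else 0) = 0 := by
      intro j
      rw [← weight_succ]
      rw [height] at h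
      fin_cases j
      · change weight m 1 = 0; omega
      · change weight m 2 = 0; omega
      · change weight m 3 = 0; omega
    have key : ∀ S : Finset (Fin 6), (∀ j : Fin 3, (if eta j ∈ S then (1 : ℤ) else 0) -
        (if xi j ∈ S then 1 else 0) = 0) →
          ∃ i, (cartanMon i).2 = S ∧ 2 * ((cartanMon i).1 - 1) + S.card = 0 := by
      decide +kernel
    obtain ⟨i, hi, hi'⟩ := key m.2 e3
    refine ⟨i, Prod.ext ?_ hi⟩
    rw [deg] at h0
    omega
  · rintro ⟨i, rfl⟩
    revert i
    decide +kernel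

/-! ### Degrees -/

/-- The monomials of degree between `-N` and `N`. -/
def degWindow (N : ℕ) : Finset Mon :=
  (Finset.Icc (-N - 3 : ℤ) (N + 3) ×ˢ Finset.univ).filter fun m => |deg m| ≤ N

theorem mem_degWindow {N : ℕ} {m : Mon} : m ∈ degWindow N ↔ |deg m| ≤ N := by
  have := card_le_six m
  rw [degWindow, Finset.mem_filter, Finset.mem_product, Finset.mem_Icc, and_iff_right_iff_imp, deg,
    abs_le]
  intro h
  exact ⟨by omega, Finset.mem_univ _⟩

theorem compl_mem_degWindow {N : ℕ} {m : Mon} (h : m ∈ degWindow N) : compl m ∈ degWindow N := by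
  rw [mem_degWindow] at h ⊢
  rwa [deg_compl, abs_neg]

theorem deg_of_bracket_ne_zero {g n m : Mon} (h : bracket (mon g) (mon n) m ≠ 0) :
    deg m = deg g + deg n := by
  have := (Finsupp.mem_supported ℂ _).1 (bracket_mem_graded (mon_mem_graded g) (mon_mem_graded n))
    (Finsupp.mem_support_iff.2 h)
  change 2 * m.1 + (m.2.card : ℤ) = _ at this
  simp only [deg] at *
  linarith

theorem card_of_bracket_ne_zero {g n m : Mon} (h : bracket (mon g) (mon n) m ≠ 0) :
    (m.2.card : ZMod 2) = (g.2.card : ZMod 2) + n.2.card :=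
  (Finsupp.mem_supported ℂ _).1 (bracket_mon_mem_homog g n) (Finsupp.mem_support_iff.2 h)

/-! ### Commutators of quadratic elements of the enveloping algebra -/

/-- In terms of coefficients, the invariance of the form says that `ad K_g` is
super-skew-symmetric. -/
theorem bracket_coeff_compl (g m n : Mon) :
    (dualSign n : ℂ) * bracket (mon g) (mon m) n =
      -((-1) ^ (g.2.card * m.2.card) * dualSign m *
        bracket (mon g) (mon (compl n)) (compl m)) := by
  rw [← form_mon_compl_apply, bracket_mon_antisymm, map_smul, LinearMap.smul_apply, form_bracket,
    form_mon_left, smul_eq_mul]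
  ring

theorem ι_mon_mul_ι_mon (m n : Mon) : ι (mon m) * ι (mon n) =
    ((-1) ^ (m.2.card * n.2.card) : ℂ) • (ι (mon n) * ι (mon m)) + ι (bracket (mon m) (mon n)) := by
  rw [ι_mul_ι (mon_mem_homog m) (mon_mem_homog n), koszul_natCast]

theorem ι_eq_sum {y : Fun} {A : Finset Mon} (h : ∀ m, y m ≠ 0 → m ∈ A) :
    ι y = ∑ m ∈ A, y m • ι (mon m) := by
  conv_lhs => rw [← Finsupp.sum_single y, Finsupp.sum_of_support_subset y
    (fun m hm => h m (Finsupp.mem_support_iff.1 hm)) _ (by simp)]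
  rw [map_sum]
  exact Finset.sum_congr rfl fun m _ => by rw [single_eq_smul_mon, map_smul]

theorem sum_compl {M : Type*} [AddCommMonoid M] {A : Finset Mon} (hA : ∀ m ∈ A, compl m ∈ A)
    (f : Mon → M) : ∑ m ∈ A, f (compl m) = ∑ m ∈ A, f m :=
  Finset.sum_nbij' compl compl hA hA (fun m _ => compl_compl_mon m) (fun m _ => compl_compl_mon m)
    fun _ _ => rfl

/-- The coefficient of `K_{n'} K_m` in the supercommutator of `K_g` with `K_n^* K_n`, coming from
the bracket of `K_g` with `K_n`; here `n'` is the complement of `n`. -/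
def adCoeff (g n m : Mon) : ℂ :=
  (-1) ^ (g.2.card * n.2.card) * dualSign n * bracket (mon g) (mon n) m

/-- The commutator of `K_g` with `K_n^* K_n`, where invariance turns the bracket of `K_g` with
`K_n^*` into coefficients of brackets with the `K_m`. -/
theorem commutator_dual_mul (g n : Mon) {A : Finset Mon} (hA : ∀ m ∈ A, compl m ∈ A)
    (h : ∀ m, bracket (mon g) (mon n) m ≠ 0 → m ∈ A)
    (h' : ∀ m, bracket (mon g) (mon (compl n)) m ≠ 0 → m ∈ A) :
    ι (mon g) * (ι (rightDual n) * ι (mon n)) - ι (rightDual n) * ι (mon n) * ι (mon g) =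
      ∑ m ∈ A, adCoeff g n m • (ι (mon (compl n)) * ι (mon m)) -
        ∑ m ∈ A, adCoeff g m n • (ι (mon (compl m)) * ι (mon n)) := by
  have h1 : ∑ m ∈ A, adCoeff g n m • (ι (mon (compl n)) * ι (mon m)) =
      ((-1) ^ (g.2.card * n.2.card) * dualSign n : ℂ) •
        (ι (mon (compl n)) * ι (bracket (mon g) (mon n))) := by
    rw [ι_eq_sum h, Finset.mul_sum, Finset.smul_sum]
    refine Finset.sum_congr rfl fun m _ => ?_
    rw [mul_smul_comm, smul_smul, adCoeff]
  have h2 : ∑ m ∈ A, adCoeff g m n • (ι (mon (compl m)) * ι (mon n)) =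
      -((dualSign n : ℂ) • (ι (bracket (mon g) (mon (compl n))) * ι (mon n))) := by
    rw [ι_eq_sum h', ← sum_compl hA fun m => bracket (mon g) (mon (compl n)) m • ι (mon m),
      Finset.sum_mul, Finset.smul_sum, ← Finset.sum_neg_distrib]
    refine Finset.sum_congr rfl fun m _ => ?_
    rw [smul_mul_assoc, smul_smul, ← neg_smul]
    congr 1
    have := bracket_coeff_compl g m n
    have e := dualSign_mul_self m
    have e' := dualSign_mul_self n
    have e'' := neg_one_pow_mul_self (g.2.card * m.2.card)
    rw [adCoeff]
    linear_combination (dualSign n * (-1) ^ (g.2.card * m.2.card) * dualSign m : ℂ) * this -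
      (-1) ^ (g.2.card * m.2.card) * dualSign m * bracket (mon g) (mon m) n * e' -
      dualSign n * bracket (mon g) (mon (compl n)) (compl m) *
        (dualSign m * dualSign m * e'' + e)
  rw [h1, h2, rightDual_eq, map_smul, smul_mul_assoc, mul_smul_comm, smul_mul_assoc, ← mul_assoc,
    ι_mon_mul_ι_mon g (compl n), add_mul, smul_mul_assoc, mul_assoc, ι_mon_mul_ι_mon g n, mul_add,
    neg_one_pow_mul_card_compl, mul_smul_comm, mul_assoc]
  simp only [smul_add, smul_smul]
  rw [neg_one_pow_mul_self, mul_one]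
  module

/-- The commutator of `K_g` with a finite weighted Casimir sum: only pairs of monomials with
different weights `ψ` contribute. -/
theorem commutator_sum (g : Mon) (ψ : Mon → ℂ) {A : Finset Mon} (hA : ∀ m ∈ A, compl m ∈ A)
    (h : ∀ n ∈ A, ψ n ≠ 0 → ∀ m, bracket (mon g) (mon n) m ≠ 0 → m ∈ A)
    (h' : ∀ n ∈ A, ψ n ≠ 0 → ∀ m, bracket (mon g) (mon (compl n)) m ≠ 0 → m ∈ A) :
    ι (mon g) * (∑ n ∈ A, ψ n • (ι (rightDual n) * ι (mon n))) -
        (∑ n ∈ A, ψ n • (ι (rightDual n) * ι (mon n))) * ι (mon g) =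
      ∑ n ∈ A, ∑ m ∈ A, ((ψ n - ψ m) * adCoeff g n m) • (ι (mon (compl n)) * ι (mon m)) := by
  have h1 : ∀ n ∈ A, ι (mon g) * (ψ n • (ι (rightDual n) * ι (mon n))) -
      (ψ n • (ι (rightDual n) * ι (mon n))) * ι (mon g) =
        ∑ m ∈ A, (ψ n * adCoeff g n m) • (ι (mon (compl n)) * ι (mon m)) -
          ∑ m ∈ A, (ψ n * adCoeff g m n) • (ι (mon (compl m)) * ι (mon n)) := by
    intro n hn
    by_cases hψ : ψ n = 0
    · simp [hψ]
    · rw [mul_smul_comm, smul_mul_assoc, ← smul_sub,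
        commutator_dual_mul g n hA (h n hn hψ) (h' n hn hψ), smul_sub, Finset.smul_sum,
        Finset.smul_sum]
      simp only [smul_smul]
  rw [Finset.mul_sum, Finset.sum_mul, ← Finset.sum_sub_distrib, Finset.sum_congr rfl h1,
    Finset.sum_sub_distrib]
  rw [Finset.sum_comm (f := fun n m => (ψ n * adCoeff g m n) • (ι (mon (compl m)) * ι (mon n))),
    ← Finset.sum_sub_distrib]
  refine Finset.sum_congr rfl fun n _ => ?_
  rw [← Finset.sum_sub_distrib]
  exact Finset.sum_congr rfl fun m _ => by rw [sub_mul, sub_smul]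

theorem neg_one_pow_mul_of_add {a b c : ℕ} (h : (c : ZMod 2) = a + b) :
    ((-1) ^ (b * c) : ℂ) = (-1) ^ (a * c) * (-1) ^ c := by
  have h' : c % 2 = (a + b) % 2 := by
    rw [← Nat.cast_add, ZMod.natCast_eq_natCast_iff'] at h
    exact h
  have hc : Even c ↔ (Even a ↔ Even b) := by
    rw [← Nat.even_add, Nat.even_iff, Nat.even_iff, h']
  rw [← pow_add]
  refine neg_one_pow_congr ?_
  rw [Nat.even_add, Nat.even_mul, Nat.even_mul]
  tauto

/-- The two quadratic terms indexed by `(n, m)` and `(m', n')` combine to a supercommutator. -/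
theorem adCoeff_smul_add_compl (g n m : Mon) :
    adCoeff g n m • (ι (mon (compl n)) * ι (mon m)) +
        adCoeff g (compl m) (compl n) • (ι (mon (compl (compl m))) * ι (mon (compl n))) =
      adCoeff g n m • ι (bracket (mon (compl n)) (mon m)) := by
  have e : adCoeff g (compl m) (compl n) =
      -((-1) ^ ((compl n).2.card * m.2.card) * adCoeff g n m) := by
    have h1 := bracket_coeff_compl g n m
    have h2 := dualSign_mul_self m
    rw [mul_comm (compl n).2.card, neg_one_pow_mul_card_compl, adCoeff, adCoeff,
      neg_one_pow_mul_card_compl, dualSign_compl]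
    by_cases h0 : bracket (mon g) (mon n) m = 0
    · rw [h0] at h1 ⊢
      rcases dualSign_eq n with hn | hn <;> simp_all
    · have h3 := neg_one_pow_mul_of_add (card_of_bracket_ne_zero h0)
      have h4 := neg_one_pow_mul_self (g.2.card * n.2.card)
      have h5 := dualSign_mul_self n
      rw [mul_comm m.2.card, h3]
      linear_combination (-1) ^ (g.2.card * m.2.card) * (-1) ^ m.2.card *
        ((-1) ^ (g.2.card * n.2.card) * dualSign n * dualSign m * h1 -
          (-1) ^ (g.2.card * n.2.card) * dualSign n * bracket (mon g) (mon n) m * h2 -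
          dualSign m * bracket (mon g) (mon (compl m)) (compl n) *
            (dualSign n * dualSign n * h4 + h5))
  rw [ι_mon_mul_ι_mon (compl n) m, compl_compl_mon, e]
  module

/-- With the sign of the weight as weight function, the commutator is linear. -/
theorem sum_rootSign_smul (g : Mon) {A : Finset Mon} (hA : ∀ m ∈ A, compl m ∈ A) :
    (2 : ℂ) • ∑ n ∈ A, ∑ m ∈ A, (((rootSign n - rootSign m : ℤ) : ℂ) * adCoeff g n m) •
        (ι (mon (compl n)) * ι (mon m)) =
      ∑ n ∈ A, ∑ m ∈ A, (((rootSign n - rootSign m : ℤ) : ℂ) * adCoeff g n m) •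
        ι (bracket (mon (compl n)) (mon m)) := by
  set f : Mon → Mon → U := fun n m =>
    (((rootSign n - rootSign m : ℤ) : ℂ) * adCoeff g n m) • (ι (mon (compl n)) * ι (mon m)) with hf
  have h : ∑ n ∈ A, ∑ m ∈ A, f n m = ∑ n ∈ A, ∑ m ∈ A, f (compl m) (compl n) := by
    rw [Finset.sum_comm, ← sum_compl hA]
    refine Finset.sum_congr rfl fun n _ => ?_
    rw [← sum_compl hA]
  rw [two_smul]
  nth_rw 2 [h]
  rw [← Finset.sum_add_distrib]
  refine Finset.sum_congr rfl fun n _ => ?_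
  rw [← Finset.sum_add_distrib]
  refine Finset.sum_congr rfl fun m _ => ?_
  rw [hf]
  simp only [rootSign_compl, sub_neg_eq_add, mul_smul, ← adCoeff_smul_add_compl, smul_add]
  rw [show -rootSign m + rootSign n = rootSign n - rootSign m by ring]

/-- The operator multiplying each root vector by the sign of its weight. -/
def signOp : Fun →ₗ[ℂ] Fun :=
  Finsupp.linearCombination ℂ fun m => (rootSign m : ℂ) • mon m

theorem signOp_mon (m : Mon) : signOp (mon m) = (rootSign m : ℂ) • mon m := by
  simp [signOp, mon]

theorem signOp_apply (f : Fun) (m : Mon) : signOp f m = rootSign m * f m := by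
  induction f using fun_induction with
  | zero => simp
  | add f f' hf hf' => simp only [map_add, Finsupp.add_apply, hf, hf', mul_add]
  | smul c n =>
    rw [map_smul, signOp_mon, mon]
    by_cases h : n = m
    · subst h; simp [mul_comm]
    · simp [h]

/-- The commutator of `ad K_g` with the operator `signOp`, applied to `K_n`. It vanishes unless
`ad K_g` changes the sign of the weight of `K_n`, which forces the degree of `K_n` to be small. -/
def signDefect (g n : Mon) : Fun :=
  (rootSign n : ℂ) • bracket (mon g) (mon n) - signOp (bracket (mon g) (mon n))

theorem signDefect_apply (g n m : Mon) :
    signDefect g n m = ((rootSign n - rootSign m : ℤ) : ℂ) * bracket (mon g) (mon n) m := by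
  rw [signDefect, Finsupp.sub_apply, signOp_apply, Finsupp.smul_apply, smul_eq_mul]
  push_cast
  ring

theorem signDefect_eq_zero {g n : Mon} {d : ℕ} (hd : |deg g| ≤ d) (hn : n ∉ degWindow d) :
    signDefect g n = 0 := by
  ext m
  rw [signDefect_apply]
  by_cases h : bracket (mon g) (mon n) m = 0
  · simp [h]
  · have hm := deg_of_bracket_ne_zero h
    rw [mem_degWindow, not_le] at hn
    rw [abs_le] at hd
    rcases lt_abs.1 hn with h0 | h0
    · rw [rootSign_of_deg_pos (by omega), rootSign_of_deg_pos (by omega)]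
      simp
    · rw [rootSign_of_deg_neg (by omega), rootSign_of_deg_neg (by omega)]
      simp

/-- Four times the element of the Lie superalgebra that is the commutator of `K_g` with the Casimir
sum without its linear correction. The parameter `d` is a bound for the degree of `K_g`. -/
def anomaly (g : Mon) (d : ℕ) : Fun :=
  ∑ n ∈ degWindow d, ((-1) ^ (g.2.card * n.2.card) * dualSign n : ℂ) •
    bracket (mon (compl n)) (signDefect g n)

theorem sum_rootSign_eq_anomaly {g : Mon} {d M : ℕ} (hd : |deg g| ≤ d) (hM : 2 * d ≤ M) :
    ∑ n ∈ degWindow M, ∑ m ∈ degWindow M, (((rootSign n - rootSign m : ℤ) : ℂ) * adCoeff g n m) •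
        ι (bracket (mon (compl n)) (mon m)) = ι (anomaly g d) := by
  have h1 : ∀ n, ∑ m ∈ degWindow M, (((rootSign n - rootSign m : ℤ) : ℂ) * adCoeff g n m) •
        ι (bracket (mon (compl n)) (mon m)) =
      ((-1) ^ (g.2.card * n.2.card) * dualSign n : ℂ) •
        ι (bracket (mon (compl n)) (∑ m ∈ degWindow M, signDefect g n m • mon m)) := by
    intro n
    simp only [map_sum, map_smul, Finset.smul_sum, smul_smul]
    refine Finset.sum_congr rfl fun m _ => ?_
    rw [signDefect_apply, adCoeff]
    congr 1
    ring
  have h2 : ∀ n ∈ degWindow d, ∑ m ∈ degWindow M, signDefect g n m • mon m = signDefect g n := by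
    intro n hn
    symm
    conv_lhs => rw [← Finsupp.sum_single (signDefect g n)]
    rw [Finsupp.sum_of_support_subset (s := degWindow M) _ _ _ (by simp)]
    · exact Finset.sum_congr rfl fun m _ => single_eq_smul_mon _ _
    · intro m hm
      rw [Finsupp.mem_support_iff, signDefect_apply] at hm
      have := deg_of_bracket_ne_zero (right_ne_zero_of_mul hm)
      rw [mem_degWindow] at hn ⊢
      rw [abs_le] at *
      omega
  have hsub : degWindow d ⊆ degWindow M := by
    intro m hm
    rw [mem_degWindow] at hm ⊢
    omega
  have h3 : ∀ n ∉ degWindow d, ∑ m ∈ degWindow M, signDefect g n m • mon m = 0 := by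
    intro n hn
    simp [signDefect_eq_zero hd hn]
  rw [anomaly, map_sum, ← Finset.sum_subset hsub]
  · refine Finset.sum_congr rfl fun n hn => ?_
    rw [h1, h2 n hn, map_smul]
  · intro n _ hn
    rw [h1, h3 n hn, map_zero, map_zero, smul_zero]

/-! ### Generators of the Lie superalgebra -/

section Generators

variable {G : Submodule ℂ Fun}

theorem mon_mem_of_smul {c : ℤ} (hc : c ≠ 0) {m : Mon} (h : (c : ℂ) • mon m ∈ G) : mon m ∈ G :=
  (Submodule.smul_mem_iff G (Int.cast_ne_zero.2 hc)).1 h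

/-- The brackets of `t ^ a` and `t ^ b` are those of the Witt algebra. -/
theorem mon_pow_mem (hG : ∀ m n, mon m ∈ G → mon n ∈ G → bracket (mon m) (mon n) ∈ G)
    (hθ : ∀ i, mon (0, {i}) ∈ G) (h3 : mon (3, ∅) ∈ G) (h1 : mon (-1, ∅) ∈ G) (a : ℤ) :
    mon (a, ∅) ∈ G := by
  have step : ∀ a b c : ℤ, a + b = c + 1 → b ≠ a → mon (a, ∅) ∈ G → mon (b, ∅) ∈ G →
      mon (c, ∅) ∈ G := by
    intro a b c hc hab ha hb
    have := hG _ _ ha hb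
    rw [bracket_mon_empty] at this
    have := mon_mem_of_smul (by simp only [Finset.card_empty]; omega) this
    rwa [show ((a, ∅) : Mon).1 + ((b, ∅) : Mon).1 - 1 = c by simp only; omega] at this
  have h0 : mon (0, ∅) ∈ G := by
    have := hG _ _ (hθ 0) (hθ 5)
    rw [bracket_mon_singleton] at this
    rw [← neg_mem_iff]
    convert this using 1
    simp [dsign, Finset.filter_singleton]
  have h2 : mon (2, ∅) ∈ G := step 0 3 2 (by norm_num) (by norm_num) h0 h3
  have hup : ∀ k : ℕ, mon (3 + k, ∅) ∈ G := by
    intro k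
    induction k with
    | zero => simpa using h3
    | succ k ih => exact step 2 (3 + k) _ (by push_cast; ring) (by omega) h2 ih
  have hdown : ∀ k : ℕ, mon (-1 - k, ∅) ∈ G := by
    intro k
    induction k with
    | zero => simpa using h1
    | succ k ih => exact step 0 (-1 - k) _ (by push_cast; ring) (by omega) h0 ih
  rcases lt_or_ge a 0 with h | h
  · have := hdown (-1 - a).toNat
    rwa [show -1 - ((-1 - a).toNat : ℤ) = a by omega] at this
  rcases lt_or_ge a 3 with h' | h'
  · interval_cases a
    · exact h0
    · exact step 0 2 1 (by norm_num) (by norm_num) h0 h2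
    · exact h2
  · have := hup (a - 3).toNat
    rwa [show 3 + ((a - 3).toNat : ℤ) = a by omega] at this

theorem mon_singleton_mem (hG : ∀ m n, mon m ∈ G → mon n ∈ G → bracket (mon m) (mon n) ∈ G)
    (hθ : ∀ i, mon (0, {i}) ∈ G) (h3 : mon (3, ∅) ∈ G) (h1 : mon (-1, ∅) ∈ G) (a : ℤ) (i : Fin 6) :
    mon (a, {i}) ∈ G := by
  have step : ∀ a b c : ℤ, a + b = c + 1 → 2 * b ≠ a → mon (b, {i}) ∈ G → mon (c, {i}) ∈ G := by
    intro a b c hc hab hb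
    have := hG _ _ (mon_pow_mem hG hθ h3 h1 a) hb
    rw [bracket_mon_empty] at this
    have := mon_mem_of_smul (by simp only [Finset.card_singleton]; omega) this
    rwa [show a + ((b, {i}) : Mon).1 - 1 = c by simp only; omega] at this
  have hne : ∀ c : ℤ, c ≠ -1 → mon (c, {i}) ∈ G := fun c hc =>
    step (c + 1) 0 c (by ring) (by omega) (hθ i)
  by_cases ha : a = -1
  · exact step (-1) 1 a (by omega) (by norm_num) (hne 1 (by norm_num))
  · exact hne a ha

/-- The bracket with `t ^ a * θ_i` produces `t ^ (a + b - 1) * θ_i * θ_T`, up to a nonzero multiple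
and a monomial with fewer odd coordinates. -/
theorem mon_insert_mem (hG : ∀ m n, mon m ∈ G → mon n ∈ G → bracket (mon m) (mon n) ∈ G)
    {a b c : ℤ} {i : Fin 6} {T : Finset (Fin 6)} (hi : i ∉ T) (ha : mon (a, {i}) ∈ G)
    (hb : mon (b, T) ∈ G) (hc : a + b = c + 1) (h0 : b ≠ a * (2 - T.card))
    (h' : i.rev ∈ T → mon (c + 1, T.erase i.rev) ∈ G) : mon (c, insert i T) ∈ G := by
  have h := hG _ _ ha hb
  rw [bracket_mon_singleton] at h
  have h2 : (dsign i.rev T : ℂ) • mon (a + b, T.erase i.rev) ∈ G := by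
    by_cases hT : i.rev ∈ T
    · rw [hc]
      exact Submodule.smul_mem _ _ (h' hT)
    · simp [dsign_of_notMem hT]
  have h1 := (Submodule.sub_mem_iff_left _ h2).1 h
  have := mon_mem_of_smul (mul_ne_zero (sub_ne_zero.2 h0) ?_) h1
  · rwa [show a + ((b, T) : Mon).1 - 1 = c by simp only; omega] at this
  · rw [Ne, mulSign_eq_zero_iff, not_not]
    simpa using hi

/-- The Lie superalgebra is generated by the odd coordinates, `t ^ 3` and `t ^ (-1)`. -/
theorem mon_mem_of_generators
    (hG : ∀ m n, mon m ∈ G → mon n ∈ G → bracket (mon m) (mon n) ∈ G)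
    (hθ : ∀ i, mon (0, {i}) ∈ G) (h3 : mon (3, ∅) ∈ G) (h1 : mon (-1, ∅) ∈ G) (m : Mon) :
    mon m ∈ G := by
  have hs := mon_singleton_mem hG hθ h3 h1
  have hins : ∀ (S : Finset (Fin 6)) (k : ℕ), S.card = k + 1 →
      ∃ i T, i ∉ T ∧ S = insert i T ∧ T.card = k := by
    intro S k hS
    obtain ⟨i, T, hi, rfl, hT⟩ := Finset.card_eq_succ.1 hS
    exact ⟨i, T, hi, rfl, hT⟩
  have card0 : ∀ (c : ℤ) (S : Finset (Fin 6)), S.card = 0 → mon (c, S) ∈ G := by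
    intro c S hS
    rw [Finset.card_eq_zero.1 hS]
    exact mon_pow_mem hG hθ h3 h1 c
  have card1 : ∀ (c : ℤ) (S : Finset (Fin 6)), S.card = 1 → mon (c, S) ∈ G := by
    intro c S hS
    obtain ⟨i, rfl⟩ := Finset.card_eq_one.1 hS
    exact hs c i
  -- one more odd coordinate, when the exponents `a` and `b` avoid a vanishing coefficient
  have step : ∀ (k : ℕ), (∀ (c : ℤ) (S : Finset (Fin 6)), S.card = k → mon (c, S) ∈ G) →
      ∀ (a b c : ℤ) (S : Finset (Fin 6)), S.card = k + 2 → a + b = c + 1 →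
        b ≠ a * (1 - k) → (∀ T : Finset (Fin 6), T.card = k + 1 → mon (b, T) ∈ G) →
        mon (c, S) ∈ G := by
    intro k hk a b c S hS hc h0 hT
    obtain ⟨i, T, hi, rfl, hTk⟩ := hins S (k + 1) hS
    refine mon_insert_mem hG hi (hs a i) (hT T hTk) hc ?_ fun hr => hk _ _ ?_
    · rw [hTk]
      convert h0 using 2
      push_cast
      ring
    · rw [Finset.card_erase_of_mem hr, hTk]
      rfl
  have card2 : ∀ (c : ℤ) (S : Finset (Fin 6)), S.card = 2 → mon (c, S) ∈ G := by
    intro c S hS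
    by_cases hc : c = -1
    · exact step 0 card0 1 (-1) c S hS (by omega) (by norm_num) fun T hT => card1 _ T hT
    · exact step 0 card0 0 (c + 1) c S hS (by omega) (by omega) fun T hT => card1 _ T hT
  have card3 : ∀ (c : ℤ) (S : Finset (Fin 6)), S.card = 3 → mon (c, S) ∈ G := fun c S hS =>
    step 1 card1 c 1 c S hS (by omega) (by norm_num) fun T hT => card2 _ T hT
  have card4' : ∀ (c : ℤ) (S : Finset (Fin 6)), c ≠ -1 → S.card = 4 → mon (c, S) ∈ G :=
    fun c S hc hS =>
      step 2 card2 0 (c + 1) c S hS (by omega) (by omega) fun T hT => card3 _ T hT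
  have card5 : ∀ (c : ℤ) (S : Finset (Fin 6)), S.card = 5 → mon (c, S) ∈ G := by
    intro c S hS
    by_cases hc : c = -1
    · exact step 3 card3 (-1) 1 c S hS (by omega) (by norm_num)
        fun T hT => card4' _ T (by norm_num) hT
    · exact step 3 card3 (c + 1) 0 c S hS (by omega) (by norm_num; omega)
        fun T hT => card4' _ T (by norm_num) hT
  -- In `{θ_i, t⁻¹θ_T} + {tθ_i, t⁻²θ_T}` the terms with `θ_i θ_T` cancel.
  have card4 : ∀ (c : ℤ) (S : Finset (Fin 6)), S.card = 4 → mon (c, S) ∈ G := by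
    intro c S hS
    by_cases hc : c = -1
    · subst hc
      obtain ⟨j, hj⟩ : ∃ j, j ∉ S := by
        by_contra! h
        rw [Finset.eq_univ_iff_forall.2 h] at hS
        simp at hS
      have hT : (insert j S).card = 5 := by rw [Finset.card_insert_of_notMem hj, hS]
      have e1 := hG _ _ (hs 0 j.rev) (card5 (-1) _ hT)
      have e2 := hG _ _ (hs 1 j.rev) (card5 (-2) _ hT)
      have e := add_mem e1 e2
      rw [bracket_mon_singleton, bracket_mon_singleton] at e
      simp only [hT, Fin.rev_rev, Finset.erase_insert hj] at e
      have hd : (-2 * dsign j (insert j S) : ℤ) ≠ 0 := by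
        rw [dsign_insert]
        positivity
      refine mon_mem_of_smul hd ?_
      convert e using 1
      norm_num
      module
    · exact card4' c S hc hS
  have card6 : ∀ (c : ℤ) (S : Finset (Fin 6)), S.card = 6 → mon (c, S) ∈ G := by
    intro c S hS
    by_cases hc : c = -1
    · exact step 4 card4 1 (-1) c S hS (by omega) (by norm_num) fun T hT => card5 _ T hT
    · exact step 4 card4 0 (c + 1) c S hS (by omega) (by omega) fun T hT => card5 _ T hT
  have hcard := card_le_six m
  obtain ⟨c, S⟩ := m
  simp only at hcard
  interval_cases h : S.card
  · exact card0 c S h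
  · exact card1 c S h
  · exact card2 c S h
  · exact card3 c S h
  · exact card4 c S h
  · exact card5 c S h
  · exact card6 c S h

end Generators

/-! ### The linear correction -/

/-- The linear combination of monomials with the listed coefficients. Lists of terms with integer
coefficients make the brackets of explicit elements computable. -/
def evalList (l : List (Mon × ℤ)) : Fun := (l.map fun p => (p.2 : ℂ) • mon p.1).sum

theorem evalList_nil : evalList [] = 0 := rfl

theorem evalList_cons (p : Mon × ℤ) (l : List (Mon × ℤ)) :
    evalList (p :: l) = (p.2 : ℂ) • mon p.1 + evalList l := rfl

theorem evalList_append (l l' : List (Mon × ℤ)) :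
    evalList (l ++ l') = evalList l + evalList l' := by
  rw [evalList, List.map_append, List.sum_append]
  rfl

theorem evalList_flatMap {α : Type*} (l : List α) (f : α → List (Mon × ℤ)) :
    evalList (l.flatMap f) = (l.map fun a => evalList (f a)).sum := by
  induction l with
  | nil => rfl
  | cons a l ih => rw [List.flatMap_cons, evalList_append, ih, List.map_cons, List.sum_cons]

/-- Multiplication of all coefficients by `c`. -/
def scaleList (c : ℤ) (l : List (Mon × ℤ)) : List (Mon × ℤ) := l.map fun p => (p.1, c * p.2)

theorem evalList_scaleList (c : ℤ) (l : List (Mon × ℤ)) :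
    evalList (scaleList c l) = (c : ℂ) • evalList l := by
  induction l with
  | nil => rw [scaleList, List.map_nil, evalList_nil, smul_zero]
  | cons p l ih =>
    rw [scaleList, List.map_cons, evalList_cons, ← scaleList, ih, evalList_cons]
    push_cast
    module

/-- Removal of the terms with coefficient zero. -/
def pruneList (l : List (Mon × ℤ)) : List (Mon × ℤ) := l.filter fun p => p.2 ≠ 0

theorem evalList_pruneList (l : List (Mon × ℤ)) : evalList (pruneList l) = evalList l := by
  induction l with
  | nil => rfl
  | cons p l ih =>
    by_cases h : p.2 = 0
    · rw [pruneList, List.filter_cons_of_neg (by simp [h]), ← pruneList, ih, evalList_cons, h]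
      simp
    · rw [pruneList, List.filter_cons_of_pos (by simp [h]), ← pruneList, evalList_cons, ih,
        evalList_cons]

/-- The terms of the bracket of two monomials. -/
def bracketList (m n : Mon) : List (Mon × ℤ) :=
  pruneList (((m.1 + n.1 - 1, m.2 ∪ n.2),
      ((2 - m.2.card) * n.1 - m.1 * (2 - n.2.card)) * mulSign m.2 n.2) ::
    ((List.finRange 6).filter fun i => i ∈ m.2 ∧ i.rev ∈ n.2).map fun i =>
      ((m.1 + n.1, m.2.erase i ∪ n.2.erase i.rev), poissonCoeff m.2 n.2 i))

theorem evalList_bracketList (m n : Mon) :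
    evalList (bracketList m n) = bracket (mon m) (mon n) := by
  have h : ∀ l : List (Fin 6), evalList ((l.filter fun i => i ∈ m.2 ∧ i.rev ∈ n.2).map fun i =>
      ((m.1 + n.1, m.2.erase i ∪ n.2.erase i.rev), poissonCoeff m.2 n.2 i)) =
        (l.map fun i => (poissonCoeff m.2 n.2 i : ℂ) •
          mon (m.1 + n.1, m.2.erase i ∪ n.2.erase i.rev)).sum := by
    intro l
    induction l with
    | nil => rfl
    | cons i l ih =>
      rw [List.map_cons, List.sum_cons, ← ih]
      by_cases hi : i ∈ m.2 ∧ i.rev ∈ n.2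
      · rw [List.filter_cons_of_pos (by simpa using hi), List.map_cons, evalList_cons]
      · rw [List.filter_cons_of_neg (by simpa using hi), poissonCoeff]
        rcases not_and_or.1 hi with hi | hi <;> simp [dsign_of_notMem hi]
  rw [bracketList, evalList_pruneList, evalList_cons, bracket_mon, h, Fin.sum_univ_def]

/-- The terms of the bracket of a monomial with a linear combination of monomials. -/
def adList (m : Mon) (l : List (Mon × ℤ)) : List (Mon × ℤ) :=
  l.flatMap fun p => scaleList p.2 (bracketList m p.1)

theorem evalList_adList (m : Mon) (l : List (Mon × ℤ)) :
    evalList (adList m l) = bracket (mon m) (evalList l) := by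
  rw [adList, evalList_flatMap, evalList, map_list_sum, List.map_map]
  congr 2
  ext1 p
  rw [evalList_scaleList, evalList_bracketList, Function.comp_apply, map_smul]

/-- The terms of `signDefect g n`. -/
def signDefectList (g n : Mon) : List (Mon × ℤ) :=
  pruneList ((bracketList g n).map fun p => (p.1, (rootSign n - rootSign p.1) * p.2))

theorem evalList_signDefectList (g n : Mon) :
    evalList (signDefectList g n) = signDefect g n := by
  have h : ∀ l : List (Mon × ℤ), evalList (l.map fun p => (p.1, (rootSign n - rootSign p.1) * p.2)) =
      (rootSign n : ℂ) • evalList l - signOp (evalList l) := by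
    intro l
    induction l with
    | nil => simp [evalList_nil]
    | cons p l ih =>
      rw [List.map_cons, evalList_cons, ih, evalList_cons, map_add, map_smul, signOp_mon]
      push_cast
      module
  rw [signDefectList, evalList_pruneList, h, evalList_bracketList, signDefect]

/-- All subsets of the set of odd coordinates. -/
def subsetList : List (Finset (Fin 6)) :=
  (List.range 64).map fun k => Finset.univ.filter fun i : Fin 6 => k.testBit i

/-- The elements of `degWindow N`. -/
def windowList (N : ℕ) : List Mon :=
  subsetList.flatMap fun S =>
    (((List.range (2 * N + 7)).map fun k : ℕ => ((k - N - 3 : ℤ), S)).filter fun m => |deg m| ≤ N)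

theorem sum_degWindow {M : Type*} [AddCommMonoid M] (N : ℕ) (f : Mon → M) :
    ∑ m ∈ degWindow N, f m = ((windowList N).map f).sum := by
  have hnd : subsetList.Nodup := by decide +kernel
  have hall : ∀ S, S ∈ subsetList := by decide +kernel
  have h : degWindow N = (windowList N).toFinset := by
    ext m
    rw [mem_degWindow, List.mem_toFinset, windowList, List.mem_flatMap]
    simp only [List.mem_filter, List.mem_map, List.mem_range, decide_eq_true_eq]
    constructor
    · intro h
      refine ⟨m.2, hall _, ⟨(m.1 + N + 3).toNat, ?_, ?_⟩, h⟩
      all_goals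
        have h' := (Finset.mem_filter.1 (mem_degWindow.2 h)).1
        rw [Finset.mem_product, Finset.mem_Icc] at h'
      · omega
      · refine Prod.ext ?_ rfl
        simp only
        omega
    · rintro ⟨S, _, _, h⟩
      exact h
  rw [h, List.sum_toFinset]
  rw [windowList, List.nodup_flatMap]
  refine ⟨fun S _ => ?_, hnd.imp ?_⟩
  · refine List.Nodup.filter _ (List.nodup_range.map ?_)
    intro k l hkl
    have := congrArg Prod.fst hkl
    simp only at this
    omega
  · intro S T hST
    rw [Function.onFun, List.disjoint_left]
    intro m hm hm'
    simp only [List.mem_filter, List.mem_map] at hm hm'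
    obtain ⟨⟨k, _, rfl⟩, _⟩ := hm
    obtain ⟨⟨l, _, h⟩, _⟩ := hm'
    exact hST (congrArg Prod.snd h).symm

/-- The terms of `anomaly g d`. -/
def anomalyList (g : Mon) (d : ℕ) : List (Mon × ℤ) :=
  (windowList d).flatMap fun n =>
    scaleList ((-1) ^ (g.2.card * n.2.card) * dualSign n) (adList (compl n) (signDefectList g n))

theorem evalList_anomalyList (g : Mon) (d : ℕ) : evalList (anomalyList g d) = anomaly g d := by
  rw [anomalyList, evalList_flatMap, anomaly, sum_degWindow]
  congr 2
  ext1 n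
  rw [evalList_scaleList, evalList_adList, evalList_signDefectList]
  push_cast
  rfl

/-- Addition of one term to a linear combination, collecting the coefficients of equal
monomials. -/
def insertTerm (p : Mon × ℤ) : List (Mon × ℤ) → List (Mon × ℤ)
  | [] => [p]
  | q :: l => if q.1 = p.1 then (q.1, q.2 + p.2) :: l else q :: insertTerm p l

theorem evalList_insertTerm (p : Mon × ℤ) (l : List (Mon × ℤ)) :
    evalList (insertTerm p l) = (p.2 : ℂ) • mon p.1 + evalList l := by
  induction l with
  | nil => rfl
  | cons q l ih =>
    rw [insertTerm]
    split_ifs with h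
    · rw [evalList_cons, evalList_cons, ← h]
      push_cast
      module
    · rw [evalList_cons, ih, evalList_cons]
      abel

/-- Whether all coefficients vanish after collecting equal monomials. -/
def vanishes (l : List (Mon × ℤ)) : Bool :=
  (l.foldr insertTerm []).all fun p => p.2 == 0

theorem evalList_eq_zero {l : List (Mon × ℤ)} (h : vanishes l = true) : evalList l = 0 := by
  have h1 : evalList (l.foldr insertTerm []) = evalList l := by
    clear h
    induction l with
    | nil => rfl
    | cons p l ih => rw [List.foldr_cons, evalList_insertTerm, ih, evalList_cons]
  rw [vanishes, List.all_eq_true] at h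
  rw [← h1, evalList]
  refine List.sum_eq_zero fun x hx => ?_
  obtain ⟨p, hp, rfl⟩ := List.mem_map.1 hx
  rw [eq_of_beq (h p hp), Int.cast_zero, zero_smul]

/-- The linear part `4 H₅ + 2 H₆ - 4 H₈` of the Casimir element. -/
def linearPart : Fun := (4 : ℂ) • H 4 + (2 : ℂ) • H 5 - (4 : ℂ) • H 7

/-- The terms of `linearPart`. -/
def linearPartList : List (Mon × ℤ) := [(cartanMon 4, 4), (cartanMon 5, 2), (cartanMon 7, -4)]

theorem evalList_linearPartList : evalList linearPartList = linearPart := by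
  simp only [linearPartList, evalList_cons, evalList_nil, linearPart, H]
  push_cast
  module

theorem anomaly_add_eq_zero {g : Mon} {d : ℕ}
    (h : vanishes (anomalyList g d ++ scaleList 4 (adList g linearPartList)) = true) :
    anomaly g d + (4 : ℂ) • bracket (mon g) linearPart = 0 := by
  rw [← evalList_anomalyList, ← evalList_linearPartList, ← evalList_adList,
    ← evalList_eq_zero h, evalList_append, evalList_scaleList]
  norm_num

/-- The linear correction for the generators `θ_i`: a finite sum over the monomials of degree between
`-1` and `1`. -/
theorem anomaly_theta (i : Fin 6) :
    anomaly (0, {i}) 1 + (4 : ℂ) • bracket (mon (0, {i})) linearPart = 0 := by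
  apply anomaly_add_eq_zero
  revert i
  decide +kernel

theorem anomaly_pow_three :
    anomaly (3, ∅) 4 + (4 : ℂ) • bracket (mon (3, ∅)) linearPart = 0 := by
  apply anomaly_add_eq_zero
  decide +kernel

theorem anomaly_pow_neg_one :
    anomaly (-1, ∅) 4 + (4 : ℂ) • bracket (mon (-1, ∅)) linearPart = 0 := by
  apply anomaly_add_eq_zero
  decide +kernel

/-! ### Truncated Casimir elements -/

/-- The summand `K_m^* K_m`. -/
def casimirTerm (m : Mon) : U := ι (rightDual m) * ι (mon m)

/-- The sum of the `K_m^* K_m` over the positive root vectors of degree at most `N`. -/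
def posSum (N : ℕ) : U := ∑ m ∈ degWindow N with 0 < height m, casimirTerm m

/-- The part of the Casimir element in the enveloping algebra of the Cartan subalgebra. -/
def cartanPart : U :=
  ∑ i : Fin 4, ι (H (Fin.castAdd 4 i)) * ι (rightDual (cartanMon (Fin.castAdd 4 i))) +
    ι linearPart

theorem two_smul_cartan_sum :
    (2 : ℂ) • ∑ i : Fin 4, ι (H (Fin.castAdd 4 i)) *
        ι (rightDual (cartanMon (Fin.castAdd 4 i))) =
      ∑ i : Fin 8, casimirTerm (cartanMon i) := by
  have h1 : ∀ i : Fin 4, compl (cartanMon (Fin.natAdd 4 i)) = cartanMon (Fin.castAdd 4 i) := by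
    decide +kernel
  have h2 : ∀ i : Fin 4, dualSign (cartanMon (Fin.natAdd 4 i)) = 1 := by
    decide +kernel
  have h3 : ∀ i : Fin 4, vanishes (bracketList (cartanMon (Fin.natAdd 4 i))
      (cartanMon (Fin.castAdd 4 i))) = true := by
    decide +kernel
  have h4 : ∀ i : Fin 4, Even (cartanMon (Fin.natAdd 4 i)).2.card := by
    decide +kernel
  rw [Fin.sum_univ_add (a := 4) (b := 4) (fun i => casimirTerm (cartanMon i)), two_smul,
    add_comm]
  congr 1
  · refine Finset.sum_congr rfl fun i _ => ?_
    rw [casimirTerm, rightDual_cartanMon, H, H, ι_mon_mul_ι_mon (cartanMon (Fin.natAdd 4 i)),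
      ((h4 i).mul_right _).neg_one_pow, one_smul, ← evalList_bracketList, evalList_eq_zero (h3 i),
      map_zero, add_zero]
  · refine Finset.sum_congr rfl fun i _ => ?_
    rw [casimirTerm, rightDual_cartanMon, rightDual_eq, h1, h2, Int.cast_one, one_smul]
    rfl

/-- The Casimir sum with the weights `1 + sgn`, which are `2`, `1` and `0` on the positive, zero and
negative weights. -/
theorem posSum_add_cartan_sum {N M : ℕ} (h : N ≤ M) :
    ∑ n ∈ degWindow M, (if deg n ≤ N then 1 + (rootSign n : ℂ) else 0) • casimirTerm n =
      (2 : ℂ) • (posSum N + ∑ i : Fin 4, ι (H (Fin.castAdd 4 i)) *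
        ι (rightDual (cartanMon (Fin.castAdd 4 i)))) := by
  have hinj : Function.Injective cartanMon := by decide +kernel
  have hz : (degWindow N).filter (fun n => rootSign n = 0) = Finset.univ.image cartanMon := by
    ext m
    rw [Finset.mem_filter, rootSign_eq_zero_iff, Finset.mem_image, mem_degWindow]
    simp only [Finset.mem_univ, true_and, and_iff_right_iff_imp]
    rintro ⟨i, rfl⟩
    have : deg (cartanMon i) = 0 := by
      revert i
      decide +kernel
    rw [this]
    simp
  have hsub : degWindow N ⊆ degWindow M := by
    intro m hm
    rw [mem_degWindow] at hm ⊢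
    omega
  rw [smul_add, two_smul_cartan_sum, posSum, Finset.smul_sum, Finset.sum_filter,
    ← Finset.sum_image (f := casimirTerm) (fun i _ j _ e => hinj e), ← hz, Finset.sum_filter,
    ← Finset.sum_add_distrib, ← Finset.sum_subset hsub]
  · refine Finset.sum_congr rfl fun n hn => ?_
    rw [mem_degWindow, abs_le] at hn
    rw [if_pos hn.2]
    rcases lt_trichotomy (height n) 0 with h0 | h0 | h0
    · have e : rootSign n = -1 := Int.sign_eq_neg_one_of_neg h0
      rw [e, if_neg (by omega), if_neg (by omega)]
      simp
    · have e : rootSign n = 0 := by rw [rootSign, h0]; rfl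
      rw [e, if_neg (by omega), if_pos rfl]
      simp
    · have e : rootSign n = 1 := Int.sign_eq_one_of_pos h0
      rw [e, if_pos h0, if_neg (by omega)]
      norm_num
  · intro n _ hn
    rw [mem_degWindow, abs_le, not_and_or] at hn
    rcases hn with hn | hn
    · rw [rootSign_of_deg_neg (by omega)]
      simp
    · rw [if_neg hn, zero_smul]

theorem smul_mem_leftIdeal {N : ℕ} (c : ℂ) {u : U} (h : u ∈ leftIdeal N) :
    c • u ∈ leftIdeal N := by
  rw [Algebra.smul_def]
  exact Ideal.mul_mem_left _ _ h

theorem ι_mon_mem_leftIdeal {N : ℕ} {m : Mon} (h : (N : ℤ) ≤ deg m) : ι (mon m) ∈ leftIdeal N :=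
  Ideal.subset_span ⟨m, h, rfl⟩

/-- The commutator of `K_g` with a truncated Casimir element lies in a left ideal that is small when
the degree of truncation is large, provided the linear part cancels the anomaly. -/
theorem commutator_truncated_mem {g : Mon} {d : ℕ} (hd : |deg g| ≤ d)
    (hg : anomaly g d + (4 : ℂ) • bracket (mon g) linearPart = 0) (K : ℕ) :
    ι (mon g) * (posSum (K + d) + cartanPart) - (posSum (K + d) + cartanPart) * ι (mon g) ∈
      leftIdeal K := by
  set M := K + 2 * d
  set ψ : Mon → ℂ := fun n => if deg n ≤ (K + d : ℕ) then 1 + (rootSign n : ℂ) else 0 with hψ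
  set P := posSum (K + d) + ∑ i : Fin 4, ι (H (Fin.castAdd 4 i)) *
    ι (rightDual (cartanMon (Fin.castAdd 4 i))) with hP
  have hd' := abs_le.1 hd
  -- a nonzero weight `ψ n` bounds the degree of `n`
  have hψ0 : ∀ n, ψ n ≠ 0 → 0 ≤ deg n ∧ deg n ≤ K + d := by
    intro n hn
    simp only [hψ] at hn
    split_ifs at hn with h
    · refine ⟨?_, by exact_mod_cast h⟩
      by_contra h'
      exact hn (by rw [rootSign_of_deg_neg (by omega)]; simp)
    · exact absurd rfl hn
  have h1 := commutator_sum g ψ (A := degWindow M) (fun m hm => compl_mem_degWindow hm)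
    (by
      intro n _ hn m hm
      have := deg_of_bracket_ne_zero hm
      have := hψ0 n hn
      rw [mem_degWindow, abs_le]
      omega)
    (by
      intro n _ hn m hm
      have := deg_of_bracket_ne_zero hm
      rw [deg_compl] at this
      have := hψ0 n hn
      rw [mem_degWindow, abs_le]
      omega)
  have h2 : ∑ n ∈ degWindow M, ψ n • (ι (rightDual n) * ι (mon n)) = (2 : ℂ) • P :=
    posSum_add_cartan_sum (by omega)
  rw [h2] at h1
  -- modulo the left ideal, the truncation of the weights at degree `K + d` is not seen
  have h3 : ∑ n ∈ degWindow M, ∑ m ∈ degWindow M,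
      ((ψ n - ψ m) * adCoeff g n m) • (ι (mon (compl n)) * ι (mon m)) -
        ∑ n ∈ degWindow M, ∑ m ∈ degWindow M,
          (((rootSign n - rootSign m : ℤ) : ℂ) * adCoeff g n m) •
            (ι (mon (compl n)) * ι (mon m)) ∈ leftIdeal K := by
    rw [← Finset.sum_sub_distrib]
    refine sum_mem fun n _ => ?_
    rw [← Finset.sum_sub_distrib]
    refine sum_mem fun m _ => ?_
    by_cases hm : (K : ℤ) ≤ deg m
    · exact sub_mem
        (smul_mem_leftIdeal _ (Ideal.mul_mem_left _ _ (ι_mon_mem_leftIdeal hm)))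
        (smul_mem_leftIdeal _ (Ideal.mul_mem_left _ _ (ι_mon_mem_leftIdeal hm)))
    · by_cases h0 : bracket (mon g) (mon n) m = 0
      · simp [adCoeff, h0]
      · have := deg_of_bracket_ne_zero h0
        convert zero_mem (leftIdeal K)
        rw [sub_eq_zero]
        simp only [hψ]
        rw [if_pos (by push_cast; omega), if_pos (by push_cast; omega)]
        congr 2
        push_cast
        ring
  rw [← h1] at h3
  have h4 := sum_rootSign_smul g (A := degWindow M) (fun m hm => compl_mem_degWindow hm)
  rw [sum_rootSign_eq_anomaly hd (by omega), eq_neg_of_add_eq_zero_left hg, map_neg, map_smul] at h4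
  have h5 : ι (mon g) * ι linearPart - ι linearPart * ι (mon g) =
      ι (bracket (mon g) linearPart) := by
    have h6 : linearPart ∈ homog 0 := by
      have : ∀ i ∈ ({4, 5, 7} : Finset (Fin 8)), ((cartanMon i).2.card : ZMod 2) = 0 := by
        decide +kernel
      refine sub_mem (add_mem ?_ ?_) ?_ <;> refine Submodule.smul_mem _ _ ?_
      · exact this 4 (by decide) ▸ mon_mem_homog (cartanMon 4)
      · exact this 5 (by decide) ▸ mon_mem_homog (cartanMon 5)
      · exact this 7 (by decide) ▸ mon_mem_homog (cartanMon 7)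
    rw [ι_mul_ι (mon_mem_homog g) h6]
    simp [koszul]
  have h7 : ι (mon g) * (posSum (K + d) + cartanPart) - (posSum (K + d) + cartanPart) * ι (mon g) =
      (2⁻¹ : ℂ) • (ι (mon g) * (2 : ℂ) • P - (2 : ℂ) • P * ι (mon g) -
        ∑ n ∈ degWindow M, ∑ m ∈ degWindow M,
          (((rootSign n - rootSign m : ℤ) : ℂ) * adCoeff g n m) •
            (ι (mon (compl n)) * ι (mon m))) := by
    have h8 : ∑ n ∈ degWindow M, ∑ m ∈ degWindow M,
          (((rootSign n - rootSign m : ℤ) : ℂ) * adCoeff g n m) •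
            (ι (mon (compl n)) * ι (mon m)) = -((2 : ℂ) • ι (bracket (mon g) linearPart)) := by
      rw [← inv_smul_smul₀ (two_ne_zero (α := ℂ)) (∑ n ∈ degWindow M, _), h4]
      module
    rw [h8, ← h5, cartanPart, ← add_assoc, ← hP]
    simp only [mul_add, add_mul, mul_smul_comm, smul_mul_assoc]
    module
  rw [h7]
  exact smul_mem_leftIdeal _ h3

/-! ### Convergence and centrality in the completion -/

open Filter Topology

instance : NonarchimedeanAddGroup U where
  is_nonarchimedean := by
    intro V hV
    obtain ⟨N, -, hN⟩ := leftIdeal_basis.hasBasis_nhds_zero.mem_iff.1 hV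
    exact ⟨leftIdeal_basis.openAddSubgroup N, hN⟩

theorem continuous_toCompleted : Continuous toCompleted :=
  UniformSpace.Completion.continuous_coe U

theorem tendsto_toCompleted_zero {α : Type*} {l : Filter α} {f : α → U}
    (h : ∀ N, ∀ᶠ a in l, f a ∈ leftIdeal N) : Tendsto (fun a => toCompleted (f a)) l (𝓝 0) := by
  have h1 : Tendsto f l (𝓝 0) :=
    leftIdeal_basis.hasBasis_nhds_zero.tendsto_right_iff.2 fun N _ => h N
  have h2 := (continuous_toCompleted.tendsto 0).comp h1
  rwa [map_zero] at h2

theorem deg_nonneg_of_height_pos {m : Mon} (h : 0 < height m) : 0 ≤ deg m := by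
  have := height_bounds m
  omega

theorem summable_casimirTerm :
    Summable fun m : {m : Mon // IsPositive m} => toCompleted (casimirTerm m.1) := by
  refine NonarchimedeanAddGroup.summable_of_tendsto_cofinite_zero
    (tendsto_toCompleted_zero fun N => ?_)
  have hfin : {m : {m : Mon // IsPositive m} | m.1 ∈ degWindow N}.Finite :=
    (degWindow N).finite_toSet.preimage Subtype.val_injective.injOn
  refine (mem_cofinite.2 ?_)
  refine hfin.subset fun m hm => ?_
  have h0 := deg_nonneg_of_height_pos ((isPositive_iff m.1).1 m.2)
  rw [Set.mem_ofPred_eq, mem_degWindow, abs_of_nonneg h0]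
  by_contra h
  exact hm (Ideal.mul_mem_left _ _ (ι_mon_mem_leftIdeal (not_le.1 h).le))

theorem tendsto_posSum {S : CompletedU}
    (hS : HasSum (fun m : {m : Mon // IsPositive m} => toCompleted (casimirTerm m.1)) S) :
    Tendsto (fun N => toCompleted (posSum N)) atTop (𝓝 S) := by
  classical
  set s : ℕ → Finset {m : Mon // IsPositive m} := fun N =>
    ((degWindow N).filter fun m => 0 < height m).subtype IsPositive with hs
  have hmono : Monotone s := by
    intro N M h m hm
    simp only [hs, Finset.mem_subtype, Finset.mem_filter, mem_degWindow] at hm ⊢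
    exact ⟨hm.1.trans (by exact_mod_cast h), hm.2⟩
  have hcov : ∀ m, ∃ N, m ∈ s N := by
    intro m
    refine ⟨(deg m.1).natAbs, ?_⟩
    simp only [hs, Finset.mem_subtype, Finset.mem_filter, mem_degWindow]
    exact ⟨by simp, (isPositive_iff m.1).1 m.2⟩
  have h1 : Tendsto (fun s : Finset {m : Mon // IsPositive m} =>
      ∑ m ∈ s, toCompleted (casimirTerm m.1)) atTop (𝓝 S) := by
    simpa only [HasSum, SummationFilter.unconditional_filter] using hS
  refine (h1.comp (tendsto_atTop_finset_of_monotone hmono hcov)).congr fun N => ?_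
  rw [Function.comp_apply, posSum, map_sum]
  exact Finset.sum_subtype_of_mem (fun m => toCompleted (casimirTerm m))
    fun m hm => (isPositive_iff m).2 (Finset.mem_filter.1 hm).2

/-- An element of `U` whose commutators with the truncated Casimir elements become small commutes
with the Casimir element. -/
theorem commute_of_forall_mem {S : CompletedU}
    (hS : HasSum (fun m : {m : Mon // IsPositive m} => toCompleted (casimirTerm m.1)) S) {u : U}
    {d : ℕ} (hu : ∀ K, u * (posSum (K + d) + cartanPart) - (posSum (K + d) + cartanPart) * u ∈
      leftIdeal K) :
    Commute (toCompleted u) (S + toCompleted cartanPart) := by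
  have h1 : Tendsto (fun K => toCompleted (posSum (K + d))) atTop (𝓝 S) :=
    (tendsto_posSum hS).comp (tendsto_add_atTop_nat d)
  have h2 : Tendsto (fun K => toCompleted (u * (posSum (K + d) + cartanPart) -
      (posSum (K + d) + cartanPart) * u)) atTop (𝓝 (toCompleted u * (S + toCompleted cartanPart) -
        (S + toCompleted cartanPart) * toCompleted u)) := by
    simp only [map_sub, map_mul, map_add]
    exact ((h1.add_const _).const_mul _).sub ((h1.add_const _).mul_const _)
  have h3 := tendsto_toCompleted_zero (l := atTop) fun N =>
    eventually_atTop.2 ⟨N, fun K hK => leftIdeal_anti hK (hu K)⟩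
  exact sub_eq_zero.1 (tendsto_nhds_unique h2 h3)

theorem casimir_mem_center {S : CompletedU}
    (hS : HasSum (fun m : {m : Mon // IsPositive m} => toCompleted (casimirTerm m.1)) S) :
    S + toCompleted cartanPart ∈ Subring.center CompletedU := by
  set C := S + toCompleted cartanPart with hC
  have hscalar : ∀ c : ℂ, Commute (toCompleted (algebraMap ℂ U c)) C := fun c =>
    commute_of_forall_mem (d := 0) hS fun K => by
      rw [Algebra.commutes, sub_self]
      exact zero_mem _
  -- the elements of the Lie superalgebra that commute with `C`
  let G : Submodule ℂ Fun :=
    { carrier := {y | Commute (toCompleted (ι y)) C}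
      add_mem' := fun {a b} ha hb => by
        rw [Set.mem_ofPred_eq, map_add, map_add]
        exact ha.add_left hb
      zero_mem' := by
        rw [Set.mem_ofPred_eq, map_zero, map_zero]
        exact Commute.zero_left _
      smul_mem' := fun c y hy => by
        rw [Set.mem_ofPred_eq, map_smul, Algebra.smul_def, map_mul]
        exact (hscalar c).mul_left hy }
  have hG : ∀ m n, mon m ∈ G → mon n ∈ G → bracket (mon m) (mon n) ∈ G := by
    intro m n hm hn
    change Commute _ _
    have e : ι (bracket (mon m) (mon n)) = ι (mon m) * ι (mon n) -
        algebraMap ℂ U ((-1) ^ (m.2.card * n.2.card)) * (ι (mon n) * ι (mon m)) := by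
      rw [ι_mon_mul_ι_mon, ← Algebra.smul_def]
      abel
    rw [e, map_sub, map_mul, map_mul, map_mul]
    exact (Commute.mul_left hm hn).sub_left ((hscalar _).mul_left (Commute.mul_left hn hm))
  have hmon : ∀ m, mon m ∈ G := by
    refine mon_mem_of_generators hG (fun i => ?_) ?_ ?_
    · exact commute_of_forall_mem hS (commutator_truncated_mem (by simp [deg]) (anomaly_theta i))
    · exact commute_of_forall_mem hS (commutator_truncated_mem (by simp [deg]) anomaly_pow_three)
    · exact commute_of_forall_mem hS
        (commutator_truncated_mem (by simp [deg]) anomaly_pow_neg_one)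
  have hι : ∀ y, y ∈ G := fun y => by
    induction y using fun_induction with
    | zero => exact zero_mem _
    | add f g hf hg => exact add_mem hf hg
    | smul c m => exact Submodule.smul_mem _ _ (hmon m)
  have hU : ∀ u : U, Commute (toCompleted u) C := by
    intro u
    let π : TensorAlgebra ℂ Fun →ₐ[ℂ] U := RingQuot.mkAlgHom ℂ Rel
    obtain ⟨z, rfl⟩ : ∃ z, π z = u := RingQuot.mkAlgHom_surjective ℂ Rel u
    induction z using TensorAlgebra.induction with
    | algebraMap r => exact (AlgHom.commutes π r).symm ▸ hscalar r
    | ι y => exact hι y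
    | mul a b ha hb => rw [map_mul, map_mul]; exact ha.mul_left hb
    | add a b ha hb => rw [map_add, map_add]; exact ha.add_left hb
  rw [Subring.mem_center_iff]
  intro x
  induction x using UniformSpace.Completion.induction_on with
  | hp => exact isClosed_eq (continuous_id.mul continuous_const) (continuous_const.mul continuous_id)
  | ih u => exact hU u

end ContactK16

end

theorem lemma1 :
    -- the weights are the eigenvalues under `ad H₄; ad H₁, ad H₂, ad H₃`
    (∀ (m : ContactK16.Mon) (i : Fin 4),
      ContactK16.bracket (ContactK16.H (ContactK16.diagIdx i)) (ContactK16.mon m) =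
        (ContactK16.weight m i : ℂ) • ContactK16.mon m) ∧
    -- the form `B` is even, supersymmetric, invariant and nondegenerate
    (∀ (p q : ZMod 2) (x y : ContactK16.Fun),
      x ∈ ContactK16.homog p → y ∈ ContactK16.homog q → p ≠ q → ContactK16.form x y = 0) ∧
    (∀ (p q : ZMod 2) (x y : ContactK16.Fun),
      x ∈ ContactK16.homog p → y ∈ ContactK16.homog q →
        ContactK16.form x y = ContactK16.koszul p q * ContactK16.form y x) ∧
    (∀ x y z : ContactK16.Fun,
      ContactK16.form (ContactK16.bracket x y) z = ContactK16.form x (ContactK16.bracket y z)) ∧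
    ContactK16.form.Nondegenerate ∧
    -- the right duals form the right dual basis, and `H_i^* = H_{i+4}` for `i = 1, …, 4`
    (∀ m n : ContactK16.Mon,
      ContactK16.form (ContactK16.mon m) (ContactK16.rightDual n) = if m = n then 1 else 0) ∧
    (∀ i : Fin 4, ContactK16.rightDual (ContactK16.cartanMon (Fin.castAdd 4 i)) =
      ContactK16.H (Fin.natAdd 4 i)) ∧
    -- the sum over the positive roots converges in the completion, and `C₂` is central there
    ∃ S : ContactK16.CompletedU,
      HasSum (fun m : {m : ContactK16.Mon // ContactK16.IsPositive m} =>
        ContactK16.toCompleted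
          (ContactK16.ι (ContactK16.rightDual m.1) * ContactK16.ι (ContactK16.mon m.1))) S ∧
      S + ContactK16.toCompleted
          (∑ i : Fin 4, ContactK16.ι (ContactK16.H (Fin.castAdd 4 i)) *
              ContactK16.ι (ContactK16.rightDual (ContactK16.cartanMon (Fin.castAdd 4 i))) +
            (4 : ℂ) • ContactK16.ι (ContactK16.H 4) + (2 : ℂ) • ContactK16.ι (ContactK16.H 5) -
            (4 : ℂ) • ContactK16.ι (ContactK16.H 7)) ∈
        Subring.center ContactK16.CompletedU := by
  refine ⟨ContactK16.bracket_diag, fun p q x y => ContactK16.form_eq_zero_of_ne,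
    fun p q x y => ContactK16.form_supersymm, ContactK16.form_bracket,
    ContactK16.form_nondegenerate, ContactK16.form_rightDual, ContactK16.rightDual_cartanMon, ?_⟩
  obtain ⟨S, hS⟩ := ContactK16.summable_casimirTerm
  refine ⟨S, hS, ?_⟩
  convert ContactK16.casimir_mem_center hS using 3
  rw [ContactK16.cartanPart, ContactK16.linearPart, map_sub, map_add, map_smul, map_smul, map_smul]
  abel
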